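/- Let $M\ge 1$, $\mathcal X=\mathbb R^{d_1}\times\dots\times\mathbb R^{d_M}$, and for $x\in\mathcal X$ write $x_m\in\mathbb R^{d_m}$ for its $m$-th block, $x_{-m}$ for the remaining blocks, and $(y_m,x_{-m})$ for $x$ with its $m$-th block replaced by $y_m$. Let $\pi(dx)=\exp(-U(x))\,dx$ be a probability measure on $\mathcal X$, and assume $$U(x)=U_0(x)+\sum_{m=1}^M U_m(x_m),$$ where every $U_m:\mathbb R^{d_m}\to\mathbb R$ is convex, $U_0:\mathcal X\to\mathbb R$ is of class $C^1$, and there are constants $L_1,\dots,L_M>0$ and $\lambda^*>0$ such that (i) for every $m$ and every $x_{-m}$, the map $x_m\mapsto\nabla_m U_0(x_m,x_{-m})$ (gradient in the $m$-th block) is $L_m$-Lipschitz for the Euclidean norm; (ii) $x\mapsto U_0(x)-\frac{\lambda^*}{2}\sum_{m=1}^M L_m\|x_m\|^2$ is convex. Put $\kappa^*=1/\lambda^*$. Let $\pi(\cdot\mid x_{-m})$ be the full conditional, i.e. the probability measure on $\mathbb R^{d_m}$ with density proportional to $y_m\mapsto\exp(-U(y_m,x_{-m}))$. For every $m$ and $x_{-m}$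 let $\bar P_m^{x_{-m}}$ be a $\pi(\cdot\mid x_{-m})$-reversible Markov kernel on $\mathbb R^{d_m}$, such that $x\mapsto\bar P_m^{x_{-m}}(x_m,A)$ is measurable on $\mathcal X$ for every Borel set $A$. Define the Metropolis-within-Gibbs kernel $$P^{\mathrm{MwG}}=\frac1M\sum_{m=1}^M\bar P_m,\qquad \bar P_m(x,A)=\int_{\mathbb R^{d_m}}\mathbf 1_A(y_m,x_{-m})\,\bar P_m^{x_{-m}}(x_m,dy_m).$$ For a probability measure $\nu$ and a $\nu$-reversible Markov kernel $P$, let $$\mathrm{Gap}(P)=\inf\left\{\frac{\langle f,(\mathrm{Id}-P)f\rangle_{L^2(\nu)}}{\mathrm{Var}_\nu(f)}\;:\; f\in L^2(\nu),\ \mathrm{Var}_\nu(f)\neq 0\right\}$$ (with $\inf\emptyset=+\infty$). Let $\beta\in\mathbb R$ be such that $\inf_{x,m}\mathrm{Gap}(\bar P_m^{x_{-m}})\ge\beta$, where the gap of $\bar P_m^{x_{-m}}$ is taken with respect to $\pi(\cdot\mid x_{-m})$. Then, with respect to $\pi$, $$\mathrm{Gap}(P^{\mathrm{MwG}})\ \ge\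 \frac{\beta}{2\kappa^* M}.$$ -/

import Mathlib

open MeasureTheory ProbabilityTheory
open scoped ENNReal NNReal

noncomputable section

/-- The state space `ℝ^{d_1} × ⋯ × ℝ^{d_M}`; every block carries the Euclidean norm. -/
abbrev BlockSpace {M : ℕ} (d : Fin M → ℕ) : Type :=
  ∀ m : Fin M, EuclideanSpace ℝ (Fin (d m))

/-- The vector `(y, x_{-m})`: `x` with its `m`-th block replaced by `y`. -/
def replaceBlock {M : ℕ} {d : Fin M → ℕ} (m : Fin M) (x : BlockSpace d)
    (y : EuclideanSpace ℝ (Fin (d m))) : BlockSpace d :=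
  Function.update x m y

/-- The gradient `∇_m V (x)` of `V` with respect to the `m`-th block. -/
def blockGradient {M : ℕ} {d : Fin M → ℕ} (V : BlockSpace d → ℝ) (m : Fin M)
    (x : BlockSpace d) : EuclideanSpace ℝ (Fin (d m)) :=
  gradient (fun y => V (replaceBlock m x y)) (x m)

/-- The measure `exp (-U(x)) dx`. -/
def gibbsMeasure {M : ℕ} {d : Fin M → ℕ} (U : BlockSpace d → ℝ) : Measure (BlockSpace d) :=
  volume.withDensity fun x => ENNReal.ofReal (Real.exp (-U x))

/-- The measure `exp (-U(y, x_{-m})) dy` on the `m`-th block. -/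
def blockSliceMeasure {M : ℕ} {d : Fin M → ℕ} (U : BlockSpace d → ℝ) (m : Fin M)
    (x : BlockSpace d) : Measure (EuclideanSpace ℝ (Fin (d m))) :=
  volume.withDensity fun y => ENNReal.ofReal (Real.exp (-U (replaceBlock m x y)))

/-- The full conditional `π(· | x_{-m})` of `π = exp (-U)`, given by its conditional density
`exp (-U(y, x_{-m})) / ∫ exp (-U(z, x_{-m})) dz`. It depends on `x` only through `x_{-m}`. -/
def fullConditional {M : ℕ} {d : Fin M → ℕ} (U : BlockSpace d → ℝ) (m : Fin M)
    (x : BlockSpace d) : Measure (EuclideanSpace ℝ (Fin (d m))) :=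
  (blockSliceMeasure U m x Set.univ)⁻¹ • blockSliceMeasure U m x

/-- The block assumption on `π = exp (-U)`, with decomposition `U = U₀ + ∑ m, U_m(x_m)`, block
smoothness constants `L_m` and convexity constant `lam` (usually written `λ^*`) relative to
`‖x‖_L² = ∑ m, L_m ‖x_m‖²`. -/
structure BlockConvexSmooth {M : ℕ} {d : Fin M → ℕ} (U U₀ : BlockSpace d → ℝ)
    (V : ∀ m : Fin M, EuclideanSpace ℝ (Fin (d m)) → ℝ) (L : Fin M → ℝ≥0) (lam : ℝ) : Prop where
  isProbabilityMeasure : IsProbabilityMeasure (gibbsMeasure U)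
  decomposition : ∀ x, U x = U₀ x + ∑ m, V m (x m)
  convex_separable : ∀ m, ConvexOn ℝ Set.univ (V m)
  contDiff : ContDiff ℝ 1 U₀
  L_pos : ∀ m, 0 < L m
  block_smooth : ∀ (m : Fin M) (x : BlockSpace d),
    LipschitzWith (L m) fun y => blockGradient U₀ m (replaceBlock m x y)
  lam_pos : 0 < lam
  strongly_convex : ConvexOn ℝ Set.univ
    fun x : BlockSpace d => U₀ x - lam / 2 * ∑ m, (L m : ℝ) * ‖x m‖ ^ 2

/-- The coordinate-wise condition number `κ^* = 1 / λ^*`. -/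
def blockConditionNumber (lam : ℝ) : ℝ := 1 / lam

/-- `⟨f, (Id - P) f⟩` in `L²(π)`. -/
def dirichletForm {α : Type*} [MeasurableSpace α] (π : Measure α) (P : Kernel α α)
    (f : α → ℝ) : ℝ :=
  ∫ x, f x * (f x - ∫ y, f y ∂(P x)) ∂π

/-- The spectral gap: the infimum of `⟨f, (Id - P) f⟩ / Var_π(f)` over the `f ∈ L²(π)` for which
the quotient makes sense, i.e. `Var_π(f) ≠ 0`. -/
def spectralGap {α : Type*} [MeasurableSpace α] (π : Measure α) (P : Kernel α α) : EReal :=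
  ⨅ (f : α → ℝ) (_ : MemLp f 2 π) (_ : variance f π ≠ 0),
    ((dirichletForm π P f / variance f π : ℝ) : EReal)

theorem measurable_replaceBlock {M : ℕ} {d : Fin M → ℕ} (m : Fin M) (x : BlockSpace d) :
    Measurable (replaceBlock m x) :=
  measurable_update x

/-- A measurable family of conditional updates of the `m`-th block is a kernel `Q` with
`Q x = P̄_m^{x_{-m}}(x_m, ·)`. This is the member `P̄_m^{x_{-m}}`, as a kernel on `ℝ^{d_m}`. -/
def conditionalUpdate {M : ℕ} {d : Fin M → ℕ} (m : Fin M)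
    (Q : Kernel (BlockSpace d) (EuclideanSpace ℝ (Fin (d m)))) (x : BlockSpace d) :
    Kernel (EuclideanSpace ℝ (Fin (d m))) (EuclideanSpace ℝ (Fin (d m))) :=
  Q.comap (replaceBlock m x) (measurable_replaceBlock m x)

/-- The kernel `P̄_m` on the whole space: `P̄_m(x, A) = ∫ 1_A(y, x_{-m}) P̄_m^{x_{-m}}(x_m, dy)`. -/
def blockKernel {M : ℕ} {d : Fin M → ℕ} (m : Fin M)
    (Q : Kernel (BlockSpace d) (EuclideanSpace ℝ (Fin (d m)))) :
    Kernel (BlockSpace d) (BlockSpace d) :=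
  (Kernel.id ×ₖ Q).map fun p => replaceBlock m p.1 p.2

/-- The Metropolis-within-Gibbs kernel `M⁻¹ ∑ m, P̄_m`. -/
def metropolisWithinGibbs {M : ℕ} {d : Fin M → ℕ}
    (Q : ∀ m : Fin M, Kernel (BlockSpace d) (EuclideanSpace ℝ (Fin (d m)))) :
    Kernel (BlockSpace d) (BlockSpace d) where
  toFun x := (M : ℝ≥0∞)⁻¹ • ∑ m, blockKernel m (Q m) x
  measurable' := by
    have h : Measurable fun x => (∑ m, blockKernel m (Q m)) x := Kernel.measurable _
    refine Measure.measurable_of_measurable_coe _ fun s hs => ?_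
    have h2 := (Measure.measurable_coe hs).comp h
    simp only [sum_apply] at h2
    simpa [Function.comp_def] using h2.const_mul ((M : ℝ≥0∞)⁻¹)

end

/-! The heart is a Poincaré inequality for the exact Gibbs sampler: for `0 < t < 1` with `t ≤ lam`,
the conditional variances of `f` given `x_{-m}`, averaged over `x` and summed over `m`, are at least
`t * Var f`. The gap hypothesis replaces each conditional variance, up to the factor `β`, by the
Dirichlet form of the conditional update. Taking `t = lam / 2` gives the stated constant.

The geometric input is `BlockConvexSmooth.sum_replaceBlock_le`. Moving one block of `x` at a time a
fraction `t` towards `y`, the `M` resulting energies sum to at most `(M - t) U(x) + t U(y)`. Block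
smoothness controls each separate move, and strong convexity controls the sum of the linear terms.

This is the pointwise hypothesis of a Prékopa–Leindler inequality with `M` functions on the right,
`lintegral_pi_pow_mul_le_prod`. Its proof inducts on coordinates, combining one-dimensional
Prékopa–Leindler with Hölder. If `a m` ignores block `m`, then `a m` has the same value at the moved
point as at `x`. A Loomis–Whitney type bound follows, `BlockConvexSmooth.lintegral_exp_sum_le`: `(∫
exp (q⁻¹ ∑ a m) dπ)^q ≤ ∏ ∫ exp (a m) dπ` with `q = M - t`.

Linearising at small centred `a m` gives `‖∑ a m‖² ≤ q ∑ ‖a m‖²` in `L²(π)`. For `a m = E[f |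
x_{-m}]` this dualises to `∑ ‖a m‖² ≤ q ‖f‖²` (`BlockConvexSmooth.sum_integral_gibbsAverage_sq_le`),
which for centred `f` is the Poincaré inequality, because the averaged conditional variance is `‖f‖²
- ‖a m‖²`. -/

/-! ### Brunn–Minkowski and Prékopa–Leindler on the line -/

/-- One-dimensional Brunn–Minkowski inequality. -/
theorem volume_add_volume_le_of_add_mem {A B C : Set ℝ} (hA : MeasurableSet A)
    (hB : MeasurableSet B) (hA' : A.Nonempty) (hB' : B.Nonempty)
    (h : ∀ a ∈ A, ∀ b ∈ B, a + b ∈ C) : volume A + volume B ≤ volume C := by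
  obtain ⟨a₀, ha₀⟩ := hA'
  obtain ⟨b₀, hb₀⟩ := hB'
  have key : ∀ K ⊆ A, IsCompact K → ∀ L ⊆ B, IsCompact L → volume K + volume L ≤ volume C := by
    intro K hK hKc L hL hLc
    have hK1 : IsCompact (insert a₀ K) := hKc.insert a₀
    have hL1 : IsCompact (insert b₀ L) := hLc.insert b₀
    -- With `a` the maximum of `K` and `b` the minimum of `L`, the translates `K + b` and `a + L`
    -- both lie in `C` and can meet only at `a + b`. Inserting `a₀` and `b₀` makes the extrema exist
    -- even when `K` or `L` is empty.
    obtain ⟨a, ha, hamax⟩ := hK1.exists_isMaxOn (Set.insert_nonempty _ _) continuousOn_id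
    obtain ⟨b, hb, hbmin⟩ := hL1.exists_isMinOn (Set.insert_nonempty _ _) continuousOn_id
    have haA : a ∈ A := (Set.insert_subset ha₀ hK) ha
    have hbB : b ∈ B := (Set.insert_subset hb₀ hL) hb
    have e1 : volume K = volume ((fun x => x + -b) ⁻¹' K) := (measure_preimage_add_right _ _ _).symm
    have e2 : volume L = volume ((fun x => -a + x) ⁻¹' L) := (measure_preimage_add _ _ _).symm
    rw [e1, e2, ← measure_union₀]
    · refine measure_mono ?_
      rintro x (hx | hx)
      · have := h _ (hK hx) b hbB
        simpa using this
      · have := h a haA _ (hL hx)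
        simpa using this
    · exact (hLc.measurableSet.preimage (measurable_const_add _)).nullMeasurableSet
    · refine measure_mono_null (t := {a + b}) ?_ (by simp)
      rintro x ⟨hx1, hx2⟩
      have h1 : x + -b ≤ a := hamax (Set.mem_insert_of_mem _ hx1)
      have h2 : b ≤ -a + x := hbmin (Set.mem_insert_of_mem _ hx2)
      simp only [Set.mem_singleton_iff]
      linarith
  rw [hA.measure_eq_iSup_isCompact, hB.measure_eq_iSup_isCompact]
  simp only [iSup_and']
  refine ENNReal.biSup_add_biSup_le' ⟨∅, by simp⟩ ⟨∅, by simp⟩ ?_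
  exact fun K hK L hL => key K hK.1 hK.2 L hL.1 hL.2

theorem smul_volume_add_smul_volume_le {t : ℝ} (ht0 : 0 < t) (ht1 : t < 1) {A B C : Set ℝ}
    (hA : MeasurableSet A) (hB : MeasurableSet B) (hA' : A.Nonempty) (hB' : B.Nonempty)
    (h : ∀ a ∈ A, ∀ b ∈ B, (1 - t) * a + t * b ∈ C) :
    ENNReal.ofReal (1 - t) * volume A + ENNReal.ofReal t * volume B ≤ volume C := by
  have hs : ∀ {c : ℝ} (S : Set ℝ), 0 < c →
      ENNReal.ofReal c * volume S = volume ((fun x => c⁻¹ * x) ⁻¹' S) := by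
    intro c S hc
    rw [Real.volume_preimage_mul_left (by positivity)]
    simp [abs_of_pos hc]
  rw [hs A (sub_pos.2 ht1), hs B ht0]
  refine volume_add_volume_le_of_add_mem (hA.preimage (measurable_const_mul _))
    (hB.preimage (measurable_const_mul _)) ?_ ?_ ?_
  · obtain ⟨a, ha⟩ := hA'
    exact ⟨(1 - t) * a, by simpa [inv_mul_cancel_left₀ (sub_pos.2 ht1).ne'] using ha⟩
  · obtain ⟨a, ha⟩ := hB'
    exact ⟨t * a, by simpa [inv_mul_cancel_left₀ ht0.ne'] using ha⟩
  · intro a ha b hb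
    have := h _ ha _ hb
    rwa [mul_inv_cancel_left₀ (sub_pos.2 ht1).ne', mul_inv_cancel_left₀ ht0.ne'] at this

/-- Layer-cake formula plus Brunn–Minkowski at each level. Since `φ` and `g` both have supremum 1,
their superlevel sets are nonempty at exactly the same positive levels, so the nonemptiness required
by Brunn–Minkowski never fails on one side only. -/
theorem lintegral_add_le_of_min_le {t : ℝ} (ht0 : 0 < t) (ht1 : t < 1) {φ g h : ℝ → ℝ}
    (hφ : Measurable φ) (hg : Measurable g) (hh : Measurable h)
    (hφ0 : ∀ x, 0 ≤ φ x) (hg0 : ∀ x, 0 ≤ g x) (hh0 : ∀ x, 0 ≤ h x)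
    (hφ1 : ∀ x, φ x ≤ 1) (hg1 : ∀ x, g x ≤ 1)
    (hφs : ∀ l < 1, ∃ x, l < φ x) (hgs : ∀ l < 1, ∃ x, l < g x)
    (H : ∀ x y, min (φ x) (g y) ≤ h ((1 - t) * x + t * y)) :
    ENNReal.ofReal (1 - t) * (∫⁻ x, ENNReal.ofReal (φ x)) +
      ENNReal.ofReal t * (∫⁻ x, ENNReal.ofReal (g x)) ≤ ∫⁻ x, ENNReal.ofReal (h x) := by
  rw [lintegral_eq_lintegral_meas_lt _ (.of_forall hφ0) hφ.aemeasurable,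
    lintegral_eq_lintegral_meas_lt _ (.of_forall hg0) hg.aemeasurable,
    lintegral_eq_lintegral_meas_lt _ (.of_forall hh0) hh.aemeasurable]
  have hmeas : ∀ u : ℝ → ℝ, Measurable fun s => volume {a | s < u a} := fun u =>
    Antitone.measurable fun s s' hss => measure_mono fun a ha => lt_of_le_of_lt hss ha
  rw [← lintegral_const_mul _ (hmeas φ), ← lintegral_const_mul _ (hmeas g),
    ← lintegral_add_left ((hmeas φ).const_mul _)]
  refine setLIntegral_mono' measurableSet_Ioi fun s hs => ?_
  by_cases h1 : s < 1
  · refine smul_volume_add_smul_volume_le ht0 ht1 (measurableSet_lt measurable_const hφ)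
      (measurableSet_lt measurable_const hg) (hφs s h1) (hgs s h1) fun a ha b hb => ?_
    exact lt_of_lt_of_le (lt_min ha hb) (H a b)
  · have e1 : {a | s < φ a} = ∅ := by
      ext a; simpa using (hφ1 a).trans (not_lt.1 h1)
    have e2 : {a | s < g a} = ∅ := by
      ext a; simpa using (hg1 a).trans (not_lt.1 h1)
    simp [e1, e2]

theorem ENNReal.geom_mean_le_arith_mean2 {t : ℝ} (ht0 : 0 < t) (ht1 : t < 1) (a b : ℝ≥0∞) :
    a ^ (1 - t) * b ^ t ≤ ENNReal.ofReal (1 - t) * a + ENNReal.ofReal t * b := by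
  have hs : 0 < 1 - t := sub_pos.2 ht1
  induction a with
  | top => rw [ENNReal.mul_top (by simpa using ht1)]; simp
  | coe a =>
    induction b with
    | top => rw [ENNReal.mul_top (a := ENNReal.ofReal t) (by simpa using ht0)]; simp
    | coe b =>
      rw [← ENNReal.coe_rpow_of_nonneg _ hs.le, ← ENNReal.coe_rpow_of_nonneg _ ht0.le,
        ENNReal.ofReal, ENNReal.ofReal]
      have := NNReal.geom_mean_le_arith_mean2_weighted (1 - t).toNNReal t.toNNReal a b
        (by rw [← Real.toNNReal_add hs.le ht0.le]; simp)
      rw [Real.coe_toNNReal _ hs.le, Real.coe_toNNReal _ ht0.le] at this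
      exact_mod_cast this

/-- One-dimensional Prékopa–Leindler inequality for bounded functions. -/
theorem prekopa_leindler_real {t : ℝ} (ht0 : 0 < t) (ht1 : t < 1) {φ g h : ℝ → ℝ≥0∞}
    (hφ : Measurable φ) (hg : Measurable g) (hh : Measurable h)
    {C : ℝ≥0∞} (hC : C ≠ ∞) (hφC : ∀ x, φ x ≤ C) (hgC : ∀ x, g x ≤ C)
    (H : ∀ x y, φ x ^ (1 - t) * g y ^ t ≤ h ((1 - t) * x + t * y)) :
    (∫⁻ x, φ x) ^ (1 - t) * (∫⁻ x, g x) ^ t ≤ ∫⁻ x, h x := by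
  have hs : 0 < 1 - t := sub_pos.2 ht1
  set A := ⨆ x, φ x with hA
  set B := ⨆ x, g x with hB
  have hAt : A ≠ ∞ := ne_top_of_le_ne_top hC (iSup_le hφC)
  have hBt : B ≠ ∞ := ne_top_of_le_ne_top hC (iSup_le hgC)
  by_cases hA0 : A = 0
  · have : ∀ x, φ x = 0 := fun x => le_antisymm ((le_iSup φ x).trans hA0.le) bot_le
    simp [this, hs]
  by_cases hB0 : B = 0
  · have : ∀ x, g x = 0 := fun x => le_antisymm ((le_iSup g x).trans hB0.le) bot_le
    simp [this, ht0]
  set D := A ^ (1 - t) * B ^ t with hD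
  have hD0 : D ≠ 0 := by
    simp [hD, ENNReal.rpow_eq_zero_iff, hA0, hB0, hAt, hBt]
  have hDt : D ≠ ∞ := ENNReal.mul_ne_top (ENNReal.rpow_ne_top_of_nonneg hs.le hAt)
    (ENNReal.rpow_ne_top_of_nonneg ht0.le hBt)
  have hle1 : ∀ {u : ℝ → ℝ≥0∞}, (⨆ x, u x) ≠ ∞ → ∀ x, u x / (⨆ x, u x) ≤ 1 :=
    fun {u} _ x => ENNReal.div_le_of_le_mul (by rw [one_mul]; exact le_iSup u x)
  have hsup : ∀ {u : ℝ → ℝ≥0∞}, (⨆ x, u x) ≠ ∞ → (⨆ x, u x) ≠ 0 → ∀ l < (1 : ℝ),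
      ∃ x, l < (u x / (⨆ x, u x)).toReal := by
    intro u hut hu0 l hl
    by_cases hl0 : l < 0
    · exact ⟨0, hl0.trans_le ENNReal.toReal_nonneg⟩
    · push Not at hl0
      have hlt : ENNReal.ofReal l * (⨆ x, u x) < ⨆ x, u x := by
        conv_rhs => rw [← one_mul (⨆ x, u x)]
        exact ENNReal.mul_lt_mul_left hu0 hut (by simpa using hl)
      obtain ⟨x, hx⟩ := lt_iSup_iff.1 hlt
      refine ⟨x, ?_⟩
      rw [← ENNReal.ofReal_lt_iff_lt_toReal hl0
        (ne_top_of_le_ne_top ENNReal.one_ne_top (hle1 hut x))]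
      rwa [ENNReal.lt_div_iff_mul_lt (Or.inl hu0) (Or.inl hut)]
  -- Dividing by `A` and `B` brings both suprema to 1, and `D` is the matching scale for `h`.
  -- Capping `h / D` at 1 keeps it finite and costs nothing, because the normalised functions are at
  -- most 1. Weighted AM–GM then returns from the additive to the multiplicative form.
  have key := lintegral_add_le_of_min_le ht0 ht1 (φ := fun x => (φ x / A).toReal)
    (g := fun x => (g x / B).toReal) (h := fun x => (min (h x / D) 1).toReal)
    (hφ.div_const A).ennreal_toReal (hg.div_const B).ennreal_toReal
    ((hh.div_const D).min measurable_const).ennreal_toReal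
    (fun x => ENNReal.toReal_nonneg) (fun x => ENNReal.toReal_nonneg)
    (fun x => ENNReal.toReal_nonneg)
    (fun x => ENNReal.toReal_le_of_le_ofReal zero_le_one (by simpa using hle1 hAt x))
    (fun x => ENNReal.toReal_le_of_le_ofReal zero_le_one (by simpa using hle1 hBt x))
    (hsup hAt hA0) (hsup hBt hB0) ?_
  · have e1 : ∀ x, ENNReal.ofReal (φ x / A).toReal = φ x / A := fun x =>
      ENNReal.ofReal_toReal (ne_top_of_le_ne_top ENNReal.one_ne_top (hle1 hAt x))
    have e2 : ∀ x, ENNReal.ofReal (g x / B).toReal = g x / B := fun x =>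
      ENNReal.ofReal_toReal (ne_top_of_le_ne_top ENNReal.one_ne_top (hle1 hBt x))
    have e3 : ∀ x, ENNReal.ofReal (min (h x / D) 1).toReal ≤ h x / D := fun x =>
      ENNReal.ofReal_toReal_le.trans (min_le_left _ _)
    simp only [e1, e2] at key
    have key2 := (ENNReal.geom_mean_le_arith_mean2 ht0 ht1 _ _).trans
      (key.trans (lintegral_mono e3))
    simp only [div_eq_mul_inv] at key2
    rw [lintegral_mul_const _ hφ, lintegral_mul_const _ hg, lintegral_mul_const _ hh,
      ENNReal.mul_rpow_of_nonneg _ _ hs.le, ENNReal.mul_rpow_of_nonneg _ _ ht0.le,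
      mul_mul_mul_comm, ENNReal.inv_rpow, ENNReal.inv_rpow, ← ENNReal.mul_inv, ← hD] at key2
    · rwa [ENNReal.mul_le_mul_iff_left (ENNReal.inv_ne_zero.2 hDt) (ENNReal.inv_ne_top.2 hD0)]
        at key2
    · left; simp [ENNReal.rpow_eq_zero_iff, hA0, hAt]
    · left; exact ENNReal.rpow_ne_top_of_nonneg hs.le hAt
  · intro x y
    have hm : min (φ x / A) (g y / B) ≤ min (h ((1 - t) * x + t * y) / D) 1 := by
      refine le_min ?_ ((min_le_left _ _).trans (hle1 hAt x))
      have h1 : (φ x / A) ^ (1 - t) * (g y / B) ^ t ≤ h ((1 - t) * x + t * y) / D := by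
        simp only [div_eq_mul_inv]
        rw [ENNReal.mul_rpow_of_nonneg _ _ hs.le, ENNReal.mul_rpow_of_nonneg _ _ ht0.le,
          mul_mul_mul_comm, ENNReal.inv_rpow, ENNReal.inv_rpow, ← ENNReal.mul_inv, ← hD]
        · gcongr; exact H x y
        · left; simp [ENNReal.rpow_eq_zero_iff, hA0, hAt]
        · left; exact ENNReal.rpow_ne_top_of_nonneg hs.le hAt
      refine le_trans ?_ h1
      calc min (φ x / A) (g y / B)
          = min (φ x / A) (g y / B) ^ (1 - t) * min (φ x / A) (g y / B) ^ t := by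
            rw [← ENNReal.rpow_add_of_nonneg _ _ hs.le ht0.le]; simp
        _ ≤ _ := by
            gcongr
            · exact min_le_left _ _
            · exact min_le_right _ _
    rw [← ENNReal.toReal_min (ne_top_of_le_ne_top ENNReal.one_ne_top (hle1 hAt x))
      (ne_top_of_le_ne_top ENNReal.one_ne_top (hle1 hBt y))]
    exact ENNReal.toReal_mono (ne_top_of_le_ne_top ENNReal.one_ne_top (min_le_right _ _)) hm

/-! ### Prékopa–Leindler with one factor per block -/

/-- `f` is bounded on `s`, and bounded away from zero there. -/
def BoundedPosOn {α : Type*} (s : Set α) (f : α → ℝ≥0∞) : Prop :=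
  ∃ c C : ℝ≥0∞, c ≠ 0 ∧ C ≠ ∞ ∧ ∀ x ∈ s, c ≤ f x ∧ f x ≤ C

theorem BoundedPosOn.ne_zero {α : Type*} {s : Set α} {f : α → ℝ≥0∞} (h : BoundedPosOn s f)
    {x : α} (hx : x ∈ s) : f x ≠ 0 := by
  obtain ⟨c, C, hc, -, H⟩ := h
  exact fun h0 => hc (le_antisymm (h0 ▸ (H x hx).1) bot_le)

theorem BoundedPosOn.ne_top {α : Type*} {s : Set α} {f : α → ℝ≥0∞} (h : BoundedPosOn s f)
    {x : α} (hx : x ∈ s) : f x ≠ ∞ := by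
  obtain ⟨c, C, -, hC, H⟩ := h
  exact ne_top_of_le_ne_top hC (H x hx).2

/-- The pointwise factorisation to which Hölder is applied: the entry at `b` is chosen so that its
`(1 - t)`-th power times the other `h m` equals `f ^ q`. -/
theorem prod_rpow_ite_eq {κ : Type*} [Fintype κ] [DecidableEq κ] {q t : ℝ} (ht1 : t < 1)
    (hq : 0 < q) (b : κ) (h : κ → ℝ≥0∞) (h0 : ∀ m, h m ≠ 0) (htop : ∀ m, h m ≠ ∞) (f : ℝ≥0∞) :
    ∏ m, (if m = b then (f ^ q / ∏ m ∈ Finset.univ.erase b, h m) ^ (1 - t)⁻¹ else h m) ^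
      (if m = b then (1 - t) / q else 1 / q) = f := by
  have hs : 0 < 1 - t := sub_pos.2 ht1
  set k := ∏ m ∈ Finset.univ.erase b, h m with hk
  have hk0 : k ≠ 0 := Finset.prod_ne_zero_iff.2 fun m _ => h0 m
  have hkt : k ≠ ∞ := ENNReal.prod_ne_top fun m _ => htop m
  rw [← Finset.mul_prod_erase _ _ (Finset.mem_univ b)]
  have : ∏ x ∈ Finset.univ.erase b, (if x = b then (f ^ q / k) ^ (1 - t)⁻¹ else h x) ^
      (if x = b then (1 - t) / q else 1 / q) = k ^ (1 / q) := by
    rw [hk, ← ENNReal.prod_rpow_of_nonneg (by positivity : 0 ≤ 1 / q)]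
    refine Finset.prod_congr rfl fun m hm => ?_
    simp [Finset.ne_of_mem_erase hm]
  rw [this]
  simp only [if_true]
  rw [← ENNReal.rpow_mul, show (1 - t)⁻¹ * ((1 - t) / q) = 1 / q by field_simp,
    ← ENNReal.mul_rpow_of_nonneg _ _ (by positivity), ENNReal.div_mul_cancel hk0 hkt,
    ← ENNReal.rpow_mul, mul_one_div_cancel hq.ne', ENNReal.rpow_one]

/-- A single coordinate belongs to one block `b`, so only `h b` sees `y`. Define `φ` by `φ^(1-t) *
∏_{m ≠ b} h m = f^q`. The hypothesis becomes the Prékopa–Leindler condition for `φ`, `g`, `h b`,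
while Hölder bounds `∫ f` through `∫ φ` and the remaining `∫ h m`. The exponents `(1 - t)/q` and
`1/q` add up to 1 precisely because `q` is the number of blocks minus `t`. -/
theorem lintegral_pow_mul_le_prod {κ : Type*} [Fintype κ] [DecidableEq κ] {t : ℝ}
    (ht0 : 0 < t) (ht1 : t < 1) {q : ℝ} (hq : q = Fintype.card κ - t) (b : κ) {I : Set ℝ}
    (hI : MeasurableSet I)
    {f g : ℝ → ℝ≥0∞} {h : κ → ℝ → ℝ≥0∞} (hf : Measurable f) (hg : Measurable g)
    (hh : ∀ m, Measurable (h m)) (bf : BoundedPosOn I f) (bg : BoundedPosOn I g)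
    (bh : ∀ m, BoundedPosOn I (h m))
    (H : ∀ x ∈ I, ∀ y ∈ I, f x ^ q * g y ^ t ≤
      ∏ m, h m (if m = b then (1 - t) * x + t * y else x))
    (hconv : ∀ x ∈ I, ∀ y ∈ I, (1 - t) * x + t * y ∈ I) :
    (∫⁻ x in I, f x) ^ q * (∫⁻ x in I, g x) ^ t ≤ ∏ m, ∫⁻ x in I, h m x := by
  have hs : 0 < 1 - t := sub_pos.2 ht1
  have hcard : (1 : ℝ) ≤ Fintype.card κ := by
    exact_mod_cast Fintype.card_pos_iff.2 ⟨b⟩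
  have hq0 : 0 < q := by linarith
  set k : ℝ → ℝ≥0∞ := fun x => ∏ m ∈ Finset.univ.erase b, h m x with hk
  have hkm : Measurable k := Finset.measurable_fun_prod _ fun m _ => hh m
  set φ : ℝ → ℝ≥0∞ := fun x => (f x ^ q / k x) ^ (1 - t)⁻¹ with hφ
  have hφm : Measurable φ := ((hf.pow_const q).div hkm).pow_const _
  have hk0 : ∀ x ∈ I, k x ≠ 0 := fun x hx =>
    Finset.prod_ne_zero_iff.2 fun m _ => (bh m).ne_zero hx
  have hkt : ∀ x ∈ I, k x ≠ ∞ := fun x hx => ENNReal.prod_ne_top fun m _ => (bh m).ne_top hx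
  have hφC : ∃ C : ℝ≥0∞, C ≠ ∞ ∧ ∀ x ∈ I, φ x ≤ C := by
    obtain ⟨_, C, _, hC, hfC⟩ := bf
    choose c _ hc _ hhc using bh
    refine ⟨(C ^ q / ∏ m ∈ Finset.univ.erase b, c m) ^ (1 - t)⁻¹, ?_, fun x hx => ?_⟩
    · refine ENNReal.rpow_ne_top_of_nonneg (by positivity) (ENNReal.div_ne_top ?_ ?_)
      · exact ENNReal.rpow_ne_top_of_nonneg hq0.le hC
      · exact Finset.prod_ne_zero_iff.2 fun m _ => hc m
    · simp only [hφ, hk]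
      gcongr with m _
      · exact (hfC x hx).2
      · exact (hhc m x hx).1
  obtain ⟨C₁, hC₁, hφC₁⟩ := hφC
  obtain ⟨_, C₂, _, hC₂, hgC₂⟩ := bg
  have pl : (∫⁻ x in I, φ x) ^ (1 - t) * (∫⁻ x in I, g x) ^ t ≤ ∫⁻ x in I, h b x := by
    rw [← lintegral_indicator hI, ← lintegral_indicator hI, ← lintegral_indicator hI]
    refine prekopa_leindler_real ht0 ht1 (hφm.indicator hI) (hg.indicator hI)
      ((hh b).indicator hI) (C := max C₁ C₂) (by simp [hC₁, hC₂]) ?_ ?_ ?_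
    · exact fun x => Set.indicator_le' (fun x hx => (hφC₁ x hx).trans (le_max_left _ _))
        (fun _ _ => bot_le) x
    · exact fun x => Set.indicator_le' (fun x hx => (hgC₂ x hx).2.trans (le_max_right _ _))
        (fun _ _ => bot_le) x
    · intro x y
      by_cases hx : x ∈ I
      swap; · simp [hx, hs]
      by_cases hy : y ∈ I
      swap; · simp [hy, ht0]
      rw [Set.indicator_of_mem hx, Set.indicator_of_mem hy,
        Set.indicator_of_mem (hconv x hx y hy)]
      have := H x hx y hy
      rw [← Finset.mul_prod_erase _ _ (Finset.mem_univ b)] at this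
      simp only [if_true] at this
      have e : ∏ m ∈ Finset.univ.erase b, h m (if m = b then (1 - t) * x + t * y else x) = k x :=
        Finset.prod_congr rfl fun m hm => by rw [if_neg (Finset.ne_of_mem_erase hm)]
      rw [e] at this
      simp only [hφ]
      rw [← ENNReal.rpow_mul, inv_mul_cancel₀ hs.ne', ENNReal.rpow_one, div_eq_mul_inv,
        mul_right_comm, ← div_eq_mul_inv]
      exact ENNReal.div_le_of_le_mul this
  have holder : (∫⁻ x in I, f x) ≤
      ∏ m, (∫⁻ x in I, (if m = b then φ x else h m x)) ^ (if m = b then (1 - t) / q else 1 / q) := by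
    refine le_trans (le_of_eq ?_) (ENNReal.lintegral_prod_norm_pow_le Finset.univ
      (f := fun m x => if m = b then φ x else h m x) ?_ ?_ ?_)
    · refine setLIntegral_congr_fun hI fun x hx => ?_
      exact (prod_rpow_ite_eq ht1 hq0 b (fun m => h m x) (fun m => (bh m).ne_zero hx)
        (fun m => (bh m).ne_top hx) (f x)).symm
    · intro m _
      by_cases hm : m = b
      · simpa [hm] using hφm.aemeasurable
      · simpa [hm] using (hh m).aemeasurable
    · rw [← Finset.add_sum_erase _ _ (Finset.mem_univ b)]
      rw [Finset.sum_congr rfl fun m hm => by rw [if_neg (Finset.ne_of_mem_erase hm)]]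
      simp only [if_true, Finset.sum_const, Finset.card_erase_of_mem (Finset.mem_univ b),
        Finset.card_univ, nsmul_eq_mul]
      rw [Nat.cast_pred (Fintype.card_pos_iff.2 ⟨b⟩)]
      field_simp
      rw [hq]; ring
    · intro m _
      split_ifs <;> positivity
  have holder2 : (∫⁻ x in I, f x) ^ q ≤
      (∫⁻ x in I, φ x) ^ (1 - t) * ∏ m ∈ Finset.univ.erase b, ∫⁻ x in I, h m x := by
    refine (ENNReal.rpow_le_rpow holder hq0.le).trans (le_of_eq ?_)
    rw [← ENNReal.prod_rpow_of_nonneg hq0.le, ← Finset.mul_prod_erase _ _ (Finset.mem_univ b)]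
    simp only [if_true]
    rw [← ENNReal.rpow_mul, div_mul_cancel₀ _ hq0.ne']
    congr 1
    refine Finset.prod_congr rfl fun m hm => ?_
    simp only [if_neg (Finset.ne_of_mem_erase hm)]
    rw [← ENNReal.rpow_mul, one_div, inv_mul_cancel₀ hq0.ne', ENNReal.rpow_one]
  rw [← Finset.mul_prod_erase _ _ (Finset.mem_univ b)]
  calc _ ≤ (∫⁻ x in I, φ x) ^ (1 - t) * (∏ m ∈ Finset.univ.erase b, ∫⁻ x in I, h m x) *
        (∫⁻ x in I, g x) ^ t := by gcongr
    _ = ((∫⁻ x in I, φ x) ^ (1 - t) * (∫⁻ x in I, g x) ^ t) *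
        ∏ m ∈ Finset.univ.erase b, ∫⁻ x in I, h m x := by ring
    _ ≤ _ := by gcongr

/-- The point with coordinates `(1 - t) x i + t y i` for `i` in block `m`, and `x i` elsewhere. -/
def blockMix {ι κ : Type*} [DecidableEq κ] (B : ι → κ) (t : ℝ) (m : κ) (x y : ι → ℝ) : ι → ℝ :=
  fun i => if m = B i then (1 - t) * x i + t * y i else x i

theorem blockMix_update {ι κ : Type*} [DecidableEq ι] [DecidableEq κ] (B : ι → κ) (t : ℝ) (m : κ)
    (x y : ι → ℝ) (i : ι) (a b : ℝ) :
    blockMix B t m (Function.update x i a) (Function.update y i b) =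
      Function.update (blockMix B t m x y) i (if m = B i then (1 - t) * a + t * b else a) := by
  ext j
  by_cases hj : j = i
  · subst hj; simp [blockMix]
  · simp [blockMix, hj]

theorem update_mem_box {ι : Type*} [DecidableEq ι] {I : Set ℝ} {x : ι → ℝ} (hx : ∀ i, x i ∈ I)
    (i : ι) {a : ℝ} (ha : a ∈ I) (j : ι) : Function.update x i a j ∈ I := by
  by_cases hj : j = i
  · subst hj; simpa using ha
  · simpa [hj] using hx j

theorem BoundedPosOn.lmarginal {ι : Type*} [DecidableEq ι] {I : Set ℝ} (hI : MeasurableSet I)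
    (hI0 : volume I ≠ 0) (hIt : volume I ≠ ∞) {f : (ι → ℝ) → ℝ≥0∞} (hf : Measurable f)
    (h : BoundedPosOn {x | ∀ i, x i ∈ I} f) (s : Finset ι) :
    BoundedPosOn {x | ∀ i, x i ∈ I} (∫⋯∫⁻_s, f ∂fun _ => volume.restrict I) := by
  induction s using Finset.induction with
  | empty => simpa using h
  | insert i s hi ih =>
    obtain ⟨c, C, hc, hC, H⟩ := ih
    refine ⟨c * volume I, C * volume I, mul_ne_zero hc hI0, ENNReal.mul_ne_top hC hIt,
      fun x hx => ?_⟩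
    rw [lmarginal_insert _ hf hi, ← setLIntegral_const, ← setLIntegral_const]
    exact ⟨setLIntegral_mono' hI fun a ha => (H _ fun j => update_mem_box hx i ha j).1,
      setLIntegral_mono' hI fun a ha => (H _ fun j => update_mem_box hx i ha j).2⟩

/-- Integrating out one coordinate preserves the shape of the inequality, which allows induction on
coordinates. On a box of finite positive volume the marginals stay bounded and bounded away from
zero, as the division in the one-coordinate step requires. -/
theorem lmarginal_pow_mul_le_prod {ι κ : Type*} [DecidableEq ι] [Fintype κ] [DecidableEq κ]
    (B : ι → κ) {t : ℝ} (ht0 : 0 < t) (ht1 : t < 1) {q : ℝ} (hq : q = Fintype.card κ - t)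
    {I : Set ℝ} (hI : MeasurableSet I) (hI0 : volume I ≠ 0) (hIt : volume I ≠ ∞)
    (hconv : ∀ x ∈ I, ∀ y ∈ I, (1 - t) * x + t * y ∈ I)
    {f g : (ι → ℝ) → ℝ≥0∞} {h : κ → (ι → ℝ) → ℝ≥0∞} (hf : Measurable f) (hg : Measurable g)
    (hh : ∀ m, Measurable (h m)) (bf : BoundedPosOn {x | ∀ i, x i ∈ I} f)
    (bg : BoundedPosOn {x | ∀ i, x i ∈ I} g) (bh : ∀ m, BoundedPosOn {x | ∀ i, x i ∈ I} (h m))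
    (H : ∀ x y, f x ^ q * g y ^ t ≤ ∏ m, h m (blockMix B t m x y)) (s : Finset ι)
    (x y : ι → ℝ) (hx : ∀ i, x i ∈ I) (hy : ∀ i, y i ∈ I) :
    (∫⋯∫⁻_s, f ∂fun _ => volume.restrict I) x ^ q *
      (∫⋯∫⁻_s, g ∂fun _ => volume.restrict I) y ^ t ≤
      ∏ m, (∫⋯∫⁻_s, h m ∂fun _ => volume.restrict I) (blockMix B t m x y) := by
  induction s using Finset.induction generalizing x y with
  | empty => simpa using H x y
  | insert i s hi ih =>
    rw [lmarginal_insert _ hf hi, lmarginal_insert _ hg hi,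
      Finset.prod_congr rfl fun m _ => lmarginal_insert _ (hh m) hi _]
    have hmix : ∀ m j, blockMix B t m x y j ∈ I := by
      intro m j
      simp only [blockMix]
      split_ifs
      · exact hconv _ (hx j) _ (hy j)
      · exact hx j
    have bdd : ∀ {u : (ι → ℝ) → ℝ≥0∞}, Measurable u → BoundedPosOn {x | ∀ i, x i ∈ I} u →
        ∀ z : ι → ℝ, (∀ i, z i ∈ I) →
        BoundedPosOn I fun a => (∫⋯∫⁻_s, u ∂fun _ => volume.restrict I) (Function.update z i a) := by
      intro u hu bu z hz
      obtain ⟨c, C, hc, hC, H⟩ := bu.lmarginal hI hI0 hIt hu s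
      exact ⟨c, C, hc, hC, fun a ha => H _ fun j => update_mem_box hz i ha j⟩
    refine lintegral_pow_mul_le_prod ht0 ht1 hq (B i) hI
      (h := fun m a => (∫⋯∫⁻_s, h m ∂fun _ => volume.restrict I)
        (Function.update (blockMix B t m x y) i a))
      ((hf.lmarginal _).comp (measurable_update x)) ((hg.lmarginal _).comp (measurable_update y))
      (fun m => ((hh m).lmarginal _).comp (measurable_update _)) (bdd hf bf x hx)
      (bdd hg bg y hy) (fun m => bdd (hh m) (bh m) _ (hmix m)) ?_ hconv
    intro a ha b hb
    have := ih (Function.update x i a) (Function.update y i b)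
      (update_mem_box hx i ha) (update_mem_box hy i hb)
    simpa only [blockMix_update] using this

theorem iUnion_pi_Icc_natCast (ι : Type*) [Finite ι] :
    ⋃ n : ℕ, {x : ι → ℝ | ∀ i, x i ∈ Set.Icc (-(n + 1 : ℝ)) (n + 1)} = Set.univ := by
  have := Fintype.ofFinite ι
  refine Set.eq_univ_of_forall fun x => Set.mem_iUnion.2 ?_
  obtain ⟨n, hn⟩ := exists_nat_ge (∑ i, |x i|)
  refine ⟨n, fun i => abs_le.1 ?_⟩
  have := Finset.single_le_sum (fun j _ => abs_nonneg (x j)) (Finset.mem_univ i)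
  linarith

/-- A reverse Brascamp–Lieb inequality of Prékopa–Leindler type: each `h m` is evaluated at the
point obtained from `x` by moving its `m`-th block towards `y`. -/
theorem lintegral_pi_pow_mul_le_prod {ι κ : Type*} [Fintype ι] [Fintype κ] [Nonempty κ]
    [DecidableEq κ]
    (B : ι → κ) {t : ℝ} (ht0 : 0 < t) (ht1 : t < 1) {q : ℝ} (hq : q = Fintype.card κ - t)
    {f g : (ι → ℝ) → ℝ≥0∞} {h : κ → (ι → ℝ) → ℝ≥0∞} (hf : Measurable f) (hg : Measurable g)
    (hh : ∀ m, Measurable (h m))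
    (bf : ∀ R : ℝ, BoundedPosOn {x | ∀ i, x i ∈ Set.Icc (-R) R} f)
    (bg : ∀ R : ℝ, BoundedPosOn {x | ∀ i, x i ∈ Set.Icc (-R) R} g)
    (bh : ∀ R : ℝ, ∀ m, BoundedPosOn {x | ∀ i, x i ∈ Set.Icc (-R) R} (h m))
    (H : ∀ x y, f x ^ q * g y ^ t ≤ ∏ m, h m (blockMix B t m x y)) :
    (∫⁻ x, f x) ^ q * (∫⁻ x, g x) ^ t ≤ ∏ m, ∫⁻ x, h m x := by
  classical
  have hq0 : 0 < q := by
    have : (1 : ℝ) ≤ Fintype.card κ := by exact_mod_cast Fintype.card_pos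
    linarith
  set S : ℕ → Set (ι → ℝ) := fun n => {x | ∀ i, x i ∈ Set.Icc (-(n + 1 : ℝ)) (n + 1)} with hS
  have hpi : ∀ n, S n = Set.univ.pi fun _ => Set.Icc (-(n + 1 : ℝ)) (n + 1) := fun n => by
    ext; simp only [hS, Set.mem_ofPred_eq, Set.mem_univ_pi]
  have hSm : Monotone S := fun n k hnk x hx i => by
    have h1 : (n : ℝ) ≤ k := by exact_mod_cast hnk
    have := hx i
    simp only [Set.mem_Icc] at this ⊢
    constructor <;> linarith
  have box : ∀ n : ℕ, (∫⁻ x in S n, f x) ^ q * (∫⁻ x in S n, g x) ^ t ≤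
      ∏ m, ∫⁻ x in S n, h m x := by
    intro n
    have hmem : ∀ i : ι, (0 : ι → ℝ) i ∈ Set.Icc (-(n + 1 : ℝ)) (n + 1) := by
      intro i
      simp only [Pi.zero_apply, Set.mem_Icc]
      constructor <;> linarith [(Nat.cast_nonneg n : (0 : ℝ) ≤ n)]
    have := lmarginal_pow_mul_le_prod B ht0 ht1 hq (I := Set.Icc (-(n + 1 : ℝ)) (n + 1))
      measurableSet_Icc (by
        rw [Real.volume_Icc]; simp only [ne_eq, ENNReal.ofReal_eq_zero, not_le]
        linarith [(Nat.cast_nonneg n : (0 : ℝ) ≤ n)])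
      (by simp [Real.volume_Icc]) (fun x hx y hy => by
        simp only [Set.mem_Icc] at hx hy ⊢
        constructor <;> nlinarith)
      hf hg hh (bf _) (bg _) (bh _) H Finset.univ 0 0 hmem hmem
    simpa only [lmarginal_univ, ← Measure.restrict_pi_pi, ← hpi, ← volume_pi] using this
  have lim : ∀ u : (ι → ℝ) → ℝ≥0∞,
      (∫⁻ x, u x) = ⨆ n, ∫⁻ x in S n, u x := by
    intro u
    rw [← setLIntegral_univ, ← iUnion_pi_Icc_natCast ι,
      setLIntegral_iUnion_of_directed _ hSm.directed_le]
  have rpow_iSup : ∀ {r : ℝ}, 0 < r → ∀ v : ℕ → ℝ≥0∞, (⨆ n, v n) ^ r = ⨆ n, v n ^ r :=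
    fun hr v => (ENNReal.orderIsoRpow _ hr).map_iSup v
  rw [lim f, lim g, rpow_iSup hq0, rpow_iSup ht0, ENNReal.iSup_mul]
  refine iSup_le fun n => ?_
  rw [ENNReal.mul_iSup]
  refine iSup_le fun k => ?_
  -- The two suprema run over independent boxes; the larger box dominates both.
  calc _ ≤ (∫⁻ x in S (max n k), f x) ^ q * (∫⁻ x in S (max n k), g x) ^ t := by
        gcongr
        · exact hSm (le_max_left n k)
        · exact hSm (le_max_right n k)
    _ ≤ ∏ m, ∫⁻ x in S (max n k), h m x := box _
    _ ≤ _ := by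
        gcongr
        exact Measure.restrict_le_self

/-! ### Smoothness and convexity of the potential -/

/-- The descent lemma. By Cauchy–Schwarz and the Lipschitz bound, the defect `r` between the two
sides along the segment has nonpositive derivative. -/
theorem le_add_inner_of_lipschitz_gradient {E : Type*} [NormedAddCommGroup E]
    [InnerProductSpace ℝ E] [CompleteSpace E] {φ : E → ℝ} (hφ : Differentiable ℝ φ) {L : ℝ≥0}
    (hL : LipschitzWith L (gradient φ)) (x v : E) :
    φ (x + v) ≤ φ x + inner ℝ (gradient φ x) v + L / 2 * ‖v‖ ^ 2 := by
  set r : ℝ → ℝ := fun s => φ (x + s • v) - s * inner ℝ (gradient φ x) v - L / 2 * s ^ 2 * ‖v‖ ^ 2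
    with hr
  have hd : ∀ s, HasDerivAt r (inner ℝ (gradient φ (x + s • v)) v - inner ℝ (gradient φ x) v -
      L * s * ‖v‖ ^ 2) s := by
    intro s
    have h1 : HasDerivAt (fun s : ℝ => x + s • v) v s := by
      simpa using ((hasDerivAt_id s).smul_const v).const_add x
    have h2 := ((hφ (x + s • v)).hasGradientAt.hasFDerivAt).comp_hasDerivAt s h1
    have h3 := (h2.sub ((hasDerivAt_id s).mul_const (inner ℝ (gradient φ x) v))).sub
      ((((hasDerivAt_id s).pow 2).const_mul (L / 2 : ℝ)).mul_const (‖v‖ ^ 2))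
    refine (h3.congr_deriv ?_)
    simp only [InnerProductSpace.toDual_apply_apply, id]
    ring
  have hanti : AntitoneOn r (Set.Icc 0 1) := by
    refine antitoneOn_of_deriv_nonpos (convex_Icc 0 1)
      (fun s _ => (hd s).continuousAt.continuousWithinAt)
      (fun s _ => (hd s).differentiableAt.differentiableWithinAt) fun s hs => ?_
    rw [interior_Icc] at hs
    rw [(hd s).deriv, ← inner_sub_left]
    have h1 := real_inner_le_norm (gradient φ (x + s • v) - gradient φ x) v
    have h2 : ‖gradient φ (x + s • v) - gradient φ x‖ ≤ L * (s * ‖v‖) := by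
      have := hL.dist_le_mul (x + s • v) x
      rwa [dist_eq_norm, dist_eq_norm, add_sub_cancel_left, norm_smul, Real.norm_eq_abs,
        abs_of_pos hs.1] at this
    nlinarith [norm_nonneg v, mul_le_mul_of_nonneg_right h2 (norm_nonneg v)]
  have := hanti (by simp : (0 : ℝ) ∈ Set.Icc (0 : ℝ) 1) (by simp : (1 : ℝ) ∈ Set.Icc (0 : ℝ) 1)
    zero_le_one
  simp only [hr, one_smul, zero_smul, add_zero] at this
  linarith

theorem norm_sq_convex_combination {E : Type*} [NormedAddCommGroup E] [InnerProductSpace ℝ E]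
    (s : ℝ) (x y : E) :
    ‖(1 - s) • x + s • y‖ ^ 2 = (1 - s) * ‖x‖ ^ 2 + s * ‖y‖ ^ 2 - s * (1 - s) * ‖y - x‖ ^ 2 := by
  rw [norm_add_sq_real, norm_sub_sq_real, norm_smul, norm_smul, inner_smul_left, inner_smul_right,
    mul_pow, mul_pow, Real.norm_eq_abs, Real.norm_eq_abs, sq_abs, sq_abs, real_inner_comm x y]
  simp
  ring

section Potential

variable {M : ℕ} {d : Fin M → ℕ}

theorem fderiv_eq_sum_inner_blockGradient {F : BlockSpace d → ℝ} (hF : Differentiable ℝ F)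
    (x v : BlockSpace d) :
    fderiv ℝ F x v = ∑ m, inner ℝ (blockGradient F m x) (v m) := by
  have hv : v = ∑ m, Pi.single m (v m) := (Finset.univ_sum_single v).symm
  conv_lhs => rw [hv, map_sum]
  refine Finset.sum_congr rfl fun m _ => ?_
  have h1 : HasFDerivAt (Function.update x m)
      (ContinuousLinearMap.single ℝ (fun m => EuclideanSpace ℝ (Fin (d m))) m) (x m) :=
    (hasFDerivAt_update x (x m)).congr_fderiv (by
      ext w j : 2
      by_cases hj : j = m
      · subst hj; simp
      · simp [hj])
  have h0 : HasFDerivAt F (fderiv ℝ F x) (Function.update x m (x m)) := by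
    rw [Function.update_eq_self]; exact (hF x).hasFDerivAt
  have h2 := h0.comp (x m) h1
  have h3 := h2.differentiableAt.hasGradientAt.hasFDerivAt.unique h2
  have h4 := DFunLike.congr_fun h3 (v m)
  rw [InnerProductSpace.toDual_apply_apply] at h4
  exact h4.symm

/-- Write convexity on the segment from `x` to `y`, divide by the parameter `s` and let `s` decrease
to 0; the factor `1 - s` in front of the quadratic gain tends to 1. -/
theorem add_fderiv_le_of_strongly_convex {F : BlockSpace d → ℝ} (hF : Differentiable ℝ F)
    {L : Fin M → ℝ≥0} {lam : ℝ}
    (hc : ConvexOn ℝ Set.univ fun x : BlockSpace d => F x - lam / 2 * ∑ m, (L m : ℝ) * ‖x m‖ ^ 2)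
    (x y : BlockSpace d) :
    F x + fderiv ℝ F x (y - x) + lam / 2 * ∑ m, (L m : ℝ) * ‖y m - x m‖ ^ 2 ≤ F y := by
  set D := ∑ m, (L m : ℝ) * ‖y m - x m‖ ^ 2 with hD
  have h1 : ∀ s ∈ Set.Ioo (0 : ℝ) 1,
      s⁻¹ • (F (x + s • (y - x)) - F x) ≤ F y - F x - lam / 2 * (1 - s) * D := by
    intro s hs
    have hcomb : x + s • (y - x) = (1 - s) • x + s • y := by module
    have := hc.2 (Set.mem_univ x) (Set.mem_univ y) (sub_nonneg.2 hs.2.le) hs.1.le (by ring)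
    simp only [Pi.add_apply, Pi.smul_apply, norm_sq_convex_combination, smul_eq_mul] at this
    have e : ∑ m, (L m : ℝ) * ((1 - s) * ‖x m‖ ^ 2 + s * ‖y m‖ ^ 2 -
        s * (1 - s) * ‖y m - x m‖ ^ 2) = (1 - s) * (∑ m, (L m : ℝ) * ‖x m‖ ^ 2) +
        s * (∑ m, (L m : ℝ) * ‖y m‖ ^ 2) - s * (1 - s) * D := by
      rw [hD, Finset.mul_sum, Finset.mul_sum, Finset.mul_sum, ← Finset.sum_add_distrib,
        ← Finset.sum_sub_distrib]
      exact Finset.sum_congr rfl fun m _ => by ring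
    rw [e, ← hcomb] at this
    rw [smul_eq_mul, inv_mul_le_iff₀ hs.1]
    linarith
  have hline : HasDerivAt (fun s : ℝ => x + s • (y - x)) (y - x) 0 := by
    simpa using ((hasDerivAt_id (0 : ℝ)).smul_const (y - x)).const_add x
  have h2 : HasDerivAt (fun s : ℝ => F (x + s • (y - x))) (fderiv ℝ F x (y - x)) 0 := by
    have h0 : HasFDerivAt F (fderiv ℝ F x) (x + (0 : ℝ) • (y - x)) := by
      simpa using (hF x).hasFDerivAt
    exact h0.comp_hasDerivAt (0 : ℝ) hline
  have h3 := h2.tendsto_slope_zero_right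
  simp only [zero_add, zero_smul, add_zero] at h3
  have h4 : Filter.Tendsto (fun s : ℝ => F y - F x - lam / 2 * (1 - s) * D)
      (nhdsWithin 0 (Set.Ioi 0)) (nhds (F y - F x - lam / 2 * (1 - 0) * D)) := by
    refine Filter.Tendsto.mono_left (Continuous.tendsto ?_ 0) nhdsWithin_le_nhds
    fun_prop
  have h5 := le_of_tendsto_of_tendsto h3 h4 (by
    filter_upwards [Ioo_mem_nhdsGT (zero_lt_one (α := ℝ))] with s hs using h1 s hs)
  linarith

namespace BlockConvexSmooth

variable {U U₀ : BlockSpace d → ℝ} {V : ∀ m : Fin M, EuclideanSpace ℝ (Fin (d m)) → ℝ}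
  {L : Fin M → ℝ≥0} {lam : ℝ}

theorem differentiable (hU : BlockConvexSmooth U U₀ V L lam) : Differentiable ℝ U₀ :=
  hU.contDiff.differentiable one_ne_zero

theorem le_add_inner (hU : BlockConvexSmooth U U₀ V L lam) (m : Fin M) (x : BlockSpace d)
    (v : EuclideanSpace ℝ (Fin (d m))) :
    U₀ (replaceBlock m x (x m + v)) ≤ U₀ x + inner ℝ (blockGradient U₀ m x) v +
      L m / 2 * ‖v‖ ^ 2 := by
  have hd : Differentiable ℝ fun y => U₀ (replaceBlock m x y) := fun y =>
    (hU.differentiable _).comp y (hasFDerivAt_update x y).differentiableAt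
  have hL : LipschitzWith (L m) (gradient fun y => U₀ (replaceBlock m x y)) := by
    have := hU.block_smooth m x
    simpa only [blockGradient, replaceBlock, Function.update_idem, Function.update_self] using this
  have := le_add_inner_of_lipschitz_gradient hd hL (x m) v
  simpa [replaceBlock, blockGradient] using this

/-- In a nonzero direction of block `m`, the quadratic upper bound from smoothness and the lower
bound from strong convexity share the same linear part, so their curvatures compare. -/
theorem lam_le_one (hU : BlockConvexSmooth U U₀ V L lam) (m : Fin M) (hm : d m ≠ 0) :
    lam ≤ 1 := by
  have : Nonempty (Fin (d m)) := ⟨⟨0, Nat.pos_of_ne_zero hm⟩⟩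
  obtain ⟨v, hv⟩ := exists_ne (0 : EuclideanSpace ℝ (Fin (d m)))
  have h1 := hU.le_add_inner m 0 v
  have h2 := add_fderiv_le_of_strongly_convex hU.differentiable hU.strongly_convex 0
    (replaceBlock m 0 ((0 : BlockSpace d) m + v))
  rw [fderiv_eq_sum_inner_blockGradient hU.differentiable,
    Finset.sum_eq_single m, Finset.sum_eq_single m] at h2
  · simp only [replaceBlock, Pi.sub_apply, Function.update_self, Pi.zero_apply, zero_add,
      sub_zero] at h1 h2
    have h3 : (lam - 1) * (L m * ‖v‖ ^ 2) ≤ 0 := by linarith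
    have h4 : 0 < (L m : ℝ) * ‖v‖ ^ 2 :=
      mul_pos (NNReal.coe_pos.2 (hU.L_pos m)) (pow_pos (norm_pos_iff.2 hv) 2)
    nlinarith
  · intro k _ hk
    simp [replaceBlock, hk]
  · simp
  · intro k _ hk
    simp [replaceBlock, hk]
  · simp

theorem continuous (hU : BlockConvexSmooth U U₀ V L lam) : Continuous U := by
  have : U = fun x => U₀ x + ∑ m, V m (x m) := funext hU.decomposition
  rw [this]
  refine hU.contDiff.continuous.add (continuous_finsetSum _ fun m _ => ?_)
  have hV : Continuous (V m) := by
    rw [← continuousOn_univ]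
    exact (hU.convex_separable m).continuousOn isOpen_univ
  exact hV.comp (continuous_apply m)

/-- Each block move has linear cost `t ⟨∇_m U₀, y_m - x_m⟩`, quadratic cost at most `t²/2 * L_m ‖y_m
- x_m‖²`, and a separable part handled by convexity of `V m`. The linear costs add up to a full
directional derivative, for which strong convexity yields a gain of `t lam / 2 * D`. Since `t ≤
lam`, this gain absorbs the total quadratic cost `t²/2 * D`. -/
theorem sum_replaceBlock_le (hU : BlockConvexSmooth U U₀ V L lam) {t : ℝ} (ht0 : 0 ≤ t)
    (ht1 : t ≤ 1) (htl : t ≤ lam) (x y : BlockSpace d) :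
    ∑ m, U (replaceBlock m x ((1 - t) • x m + t • y m)) ≤ (M - t) * U x + t * U y := by
  have h1 : ∀ m, U (replaceBlock m x ((1 - t) • x m + t • y m)) ≤
      U x + t * inner ℝ (blockGradient U₀ m x) (y m - x m) +
        t ^ 2 / 2 * (L m * ‖y m - x m‖ ^ 2) + t * (V m (y m) - V m (x m)) := by
    intro m
    have e : (1 - t) • x m + t • y m = x m + t • (y m - x m) := by module
    have hd := hU.le_add_inner m x (t • (y m - x m))
    rw [← e, inner_smul_right, norm_smul, mul_pow, Real.norm_eq_abs, sq_abs] at hd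
    have hV := (hU.convex_separable m).2 (Set.mem_univ (x m)) (Set.mem_univ (y m))
      (sub_nonneg.2 ht1) ht0 (by ring)
    simp only [smul_eq_mul] at hV
    have hs : ∑ k, V k (replaceBlock m x ((1 - t) • x m + t • y m) k) =
        ∑ k, V k (x k) + (V m ((1 - t) • x m + t • y m) - V m (x m)) := by
      rw [← Finset.add_sum_erase _ _ (Finset.mem_univ m),
        ← Finset.add_sum_erase _ (fun k => V k (x k)) (Finset.mem_univ m)]
      have : ∑ k ∈ Finset.univ.erase m, V k (replaceBlock m x ((1 - t) • x m + t • y m) k) =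
          ∑ k ∈ Finset.univ.erase m, V k (x k) :=
        Finset.sum_congr rfl fun k hk => by
          simp [replaceBlock, Finset.ne_of_mem_erase hk]
      rw [this]
      simp only [replaceBlock, Function.update_self, Finset.sum_erase_eq_sub (Finset.mem_univ m)]
      ring
    rw [hU.decomposition, hU.decomposition x, hs]
    linarith
  have h2 := Finset.sum_le_sum fun m (_ : m ∈ Finset.univ) => h1 m
  have h3 := add_fderiv_le_of_strongly_convex hU.differentiable hU.strongly_convex x y
  rw [fderiv_eq_sum_inner_blockGradient hU.differentiable] at h3
  simp only [Finset.sum_add_distrib, ← Finset.mul_sum, Finset.sum_sub_distrib, Finset.sum_const,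
    Finset.card_univ, Fintype.card_fin, nsmul_eq_mul, Pi.sub_apply] at h2 h3
  set D := ∑ m, (L m : ℝ) * ‖y m - x m‖ ^ 2
  have hD : 0 ≤ D := Finset.sum_nonneg fun m _ => mul_nonneg (L m).2 (sq_nonneg _)
  have h4 := mul_le_mul_of_nonneg_left h3 ht0
  have h5 : t * t * D ≤ t * lam * D := by gcongr
  have hx := hU.decomposition x
  have hy := hU.decomposition y
  calc _ ≤ _ := h2
    _ ≤ _ := by
      rw [hx, hy]
      nlinarith

end BlockConvexSmooth

end Potential

/-! ### The Loomis–Whitney type inequality for the Gibbs measure -/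

/-- The point of `BlockSpace d` with coordinates `x`. -/
def blockOfCoords {M : ℕ} {d : Fin M → ℕ} (x : ((m : Fin M) × Fin (d m)) → ℝ) : BlockSpace d :=
  fun m => WithLp.toLp 2 fun j => x ⟨m, j⟩

theorem measurePreserving_sigmaUncurry {ι : Type*} {κ : ι → Type*} [Fintype ι]
    [∀ i, Fintype (κ i)] :
    MeasurePreserving (MeasurableEquiv.piCurry fun (i : ι) (_ : κ i) => ℝ).symm := by
  refine ⟨MeasurableEquiv.measurable _, ?_⟩
  refine (Measure.pi_eq fun s hs => ?_).symm
  rw [Measure.map_apply (MeasurableEquiv.measurable _) (MeasurableSet.univ_pi hs)]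
  have : (MeasurableEquiv.piCurry fun (i : ι) (_ : κ i) => ℝ).symm ⁻¹' Set.univ.pi s =
      Set.univ.pi fun i => Set.univ.pi fun j => s ⟨i, j⟩ := by
    ext x
    simp [Set.mem_pi, Sigma.forall, Sigma.uncurry]
  rw [this, volume_pi_pi, Fintype.prod_sigma]
  exact Finset.prod_congr rfl fun i _ => volume_pi_pi _

theorem measurePreserving_blockOfCoords {M : ℕ} {d : Fin M → ℕ} :
    MeasurePreserving (blockOfCoords (d := d)) :=
  (volume_preserving_pi fun m => PiLp.volume_preserving_toLp (Fin (d m))).comp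
    (measurePreserving_sigmaUncurry.symm
      (MeasurableEquiv.piCurry fun (m : Fin M) (_ : Fin (d m)) => ℝ).symm)

theorem continuous_blockOfCoords {M : ℕ} {d : Fin M → ℕ} :
    Continuous (blockOfCoords (d := d)) :=
  continuous_pi fun m => (PiLp.continuous_toLp 2 _).comp
    (continuous_pi fun j => continuous_apply (⟨m, j⟩ : (m : Fin M) × Fin (d m)))

theorem blockOfCoords_blockMix {M : ℕ} {d : Fin M → ℕ} (t : ℝ) (m : Fin M)
    (x y : ((m : Fin M) × Fin (d m)) → ℝ) :
    blockOfCoords (blockMix Sigma.fst t m x y) = replaceBlock m (blockOfCoords x)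
      ((1 - t) • blockOfCoords x m + t • blockOfCoords y m) := by
  funext k
  by_cases hk : k = m
  · subst hk
    ext j
    simp [blockOfCoords, replaceBlock, blockMix]
  · ext j
    simp [blockOfCoords, replaceBlock, blockMix, hk, Ne.symm hk]

theorem boundedPosOn_ofReal_exp {α : Type*} {s : Set α} {v : α → ℝ} {C : ℝ}
    (h : ∀ x ∈ s, |v x| ≤ C) : BoundedPosOn s fun x => ENNReal.ofReal (Real.exp (v x)) := by
  refine ⟨ENNReal.ofReal (Real.exp (-C)), ENNReal.ofReal (Real.exp C), ?_, ENNReal.ofReal_ne_top,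
    fun x hx => ?_⟩
  · simpa using Real.exp_pos _
  · have := abs_le.1 (h x hx)
    exact ⟨ENNReal.ofReal_le_ofReal (Real.exp_le_exp.2 this.1),
      ENNReal.ofReal_le_ofReal (Real.exp_le_exp.2 this.2)⟩

theorem ENNReal.ofReal_exp_rpow (v r : ℝ) :
    ENNReal.ofReal (Real.exp v) ^ r = ENNReal.ofReal (Real.exp (r * v)) := by
  rw [ENNReal.ofReal_rpow_of_pos (Real.exp_pos v), ← Real.exp_mul, mul_comm]

theorem lintegral_gibbsMeasure {M : ℕ} {d : Fin M → ℕ} {U : BlockSpace d → ℝ}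
    (hU : Continuous U) {f : BlockSpace d → ℝ≥0∞} (hf : Measurable f) :
    ∫⁻ x, f x ∂gibbsMeasure U = ∫⁻ x, ENNReal.ofReal (Real.exp (-U x)) * f x := by
  rw [gibbsMeasure, lintegral_withDensity_eq_lintegral_mul _ (by fun_prop) hf]
  rfl

/-- A Loomis–Whitney type inequality for `exp (-U)`: the function `a m` does not depend on the
`m`-th block. -/
theorem BlockConvexSmooth.lintegral_exp_sum_le {M : ℕ} (hM : 0 < M) {d : Fin M → ℕ}
    {U U₀ : BlockSpace d → ℝ} {V : ∀ m : Fin M, EuclideanSpace ℝ (Fin (d m)) → ℝ}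
    {L : Fin M → ℝ≥0} {lam : ℝ} (hU : BlockConvexSmooth U U₀ V L lam) {t : ℝ} (ht0 : 0 < t)
    (ht1 : t < 1) (htl : t ≤ lam) {a : Fin M → BlockSpace d → ℝ} (ha : ∀ m, Measurable (a m))
    {C : ℝ} (haC : ∀ m x, |a m x| ≤ C) (hinv : ∀ m x y, a m (replaceBlock m x y) = a m x) :
    (∫⁻ x, ENNReal.ofReal (Real.exp ((M - t)⁻¹ * ∑ m, a m x)) ∂gibbsMeasure U) ^ (M - t) ≤
      ∏ m, ∫⁻ x, ENNReal.ofReal (Real.exp (a m x)) ∂gibbsMeasure U := by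
  have : Nonempty (Fin M) := ⟨⟨0, hM⟩⟩
  have hM1 : (1 : ℝ) ≤ M := by exact_mod_cast hM
  have hq0 : (0 : ℝ) < M - t := by linarith
  have hUm : Measurable U := hU.continuous.measurable
  have hbm : Measurable (blockOfCoords (d := d)) := continuous_blockOfCoords.measurable
  have hbox : ∀ R : ℝ, ∃ K, ∀ x : ((m : Fin M) × Fin (d m)) → ℝ,
      (∀ i, x i ∈ Set.Icc (-R) R) → |U (blockOfCoords x)| ≤ K := by
    intro R
    have hc : IsCompact (Set.univ.pi fun _ : (m : Fin M) × Fin (d m) => Set.Icc (-R) R) :=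
      isCompact_univ_pi fun _ => isCompact_Icc
    obtain ⟨K, hK⟩ := hc.exists_bound_of_continuousOn
      (f := fun x => U (blockOfCoords x)) (hU.continuous.comp continuous_blockOfCoords).continuousOn
    exact ⟨K, fun x hx => hK x fun i _ => hx i⟩
  -- The choice `g = exp (-U)` has integral 1, so its factor disappears from the conclusion.
  have key := lintegral_pi_pow_mul_le_prod (Sigma.fst : ((m : Fin M) × Fin (d m)) → Fin M)
    ht0 ht1 (q := M - t) (by simp)
    (f := fun x => ENNReal.ofReal (Real.exp
      (-U (blockOfCoords x) + (M - t)⁻¹ * ∑ m, a m (blockOfCoords x))))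
    (g := fun x => ENNReal.ofReal (Real.exp (-U (blockOfCoords x))))
    (h := fun m x => ENNReal.ofReal (Real.exp (-U (blockOfCoords x) + a m (blockOfCoords x))))
    (by fun_prop) (by fun_prop) (fun m => by have := ha m; fun_prop)
    (fun R => by
      obtain ⟨K, hK⟩ := hbox R
      refine boundedPosOn_ofReal_exp (C := K + (M - t)⁻¹ * ∑ _m : Fin M, C) fun x hx => ?_
      refine (abs_add_le _ _).trans (add_le_add (by rw [abs_neg]; exact hK x hx) ?_)
      rw [abs_mul, abs_of_pos (inv_pos.2 hq0)]
      gcongr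
      exact (Finset.abs_sum_le_sum_abs _ _).trans (Finset.sum_le_sum fun m _ => haC m _))
    (fun R => by
      obtain ⟨K, hK⟩ := hbox R
      exact boundedPosOn_ofReal_exp (C := K) fun x hx => by rw [abs_neg]; exact hK x hx)
    (fun R m => by
      obtain ⟨K, hK⟩ := hbox R
      refine boundedPosOn_ofReal_exp (C := K + C) fun x hx => ?_
      exact (abs_add_le _ _).trans (add_le_add (by rw [abs_neg]; exact hK x hx) (haC m _)))
    ?_
  · have hmp : ∀ {u : BlockSpace d → ℝ}, Measurable u →
        ∫⁻ x, ENNReal.ofReal (Real.exp (-U (blockOfCoords x) + u (blockOfCoords x))) =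
          ∫⁻ x, ENNReal.ofReal (Real.exp (u x)) ∂gibbsMeasure U := by
      intro u hu
      rw [measurePreserving_blockOfCoords.lintegral_comp
        (f := fun x => ENNReal.ofReal (Real.exp (-U x + u x))) (by fun_prop),
        lintegral_gibbsMeasure hU.continuous (by fun_prop)]
      refine lintegral_congr fun x => ?_
      rw [Real.exp_add, ENNReal.ofReal_mul (Real.exp_pos _).le]
    have hg : ∫⁻ x, ENNReal.ofReal (Real.exp (-U (blockOfCoords (d := d) x))) = 1 := by
      have := hU.isProbabilityMeasure
      simpa using hmp (u := fun _ => 0) measurable_const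
    rw [hg, ENNReal.one_rpow, mul_one,
      hmp (u := fun x => (M - t)⁻¹ * ∑ m, a m x) (by fun_prop)] at key
    refine key.trans (le_of_eq (Finset.prod_congr rfl fun m _ => hmp (ha m)))
  · intro x y
    rw [ENNReal.ofReal_exp_rpow, ENNReal.ofReal_exp_rpow, ← ENNReal.ofReal_mul (Real.exp_pos _).le,
      ← ENNReal.ofReal_prod_of_nonneg fun m _ => (Real.exp_pos _).le, ← Real.exp_add,
      ← Real.exp_sum]
    refine ENNReal.ofReal_le_ofReal (Real.exp_le_exp.2 ?_)
    -- The `m`-th mixed point differs from `x` only in block `m`, so `a m` keeps its value there.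
    -- The terms in `a` cancel and only the potential inequality remains.
    simp only [blockOfCoords_blockMix, hinv]
    rw [Finset.sum_add_distrib, Finset.sum_neg_distrib, mul_add, mul_inv_cancel_left₀ hq0.ne']
    linarith [hU.sum_replaceBlock_le ht0.le ht1.le htl (blockOfCoords x) (blockOfCoords y)]

/-! ### Second-order expansion of exponential moments -/

theorem integrable_of_measurable_of_abs_le {α : Type*} [MeasurableSpace α] {μ : Measure α}
    [IsFiniteMeasure μ] {X : α → ℝ} (hX : Measurable X) {C : ℝ} (hC : ∀ x, |X x| ≤ C) :
    Integrable X μ :=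
  .of_bound hX.aestronglyMeasurable C (.of_forall hC)

theorem abs_integral_exp_sub_le {α : Type*} [MeasurableSpace α] {μ : Measure α}
    [IsProbabilityMeasure μ] {X : α → ℝ} (hX : Measurable X) {C : ℝ} (hC : ∀ x, |X x| ≤ C)
    (hX0 : ∫ x, X x ∂μ = 0) {e : ℝ} (he : 0 ≤ e) (heC : e * C ≤ 1) :
    |∫ x, Real.exp (e * X x) ∂μ - 1 - e ^ 2 / 2 * ∫ x, X x ^ 2 ∂μ| ≤ (e * C) ^ 3 := by
  have hb : ∀ x, |e * X x| ≤ e * C := fun x => by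
    rw [abs_mul, abs_of_nonneg he]; exact mul_le_mul_of_nonneg_left (hC x) he
  have i1 : Integrable (fun x => Real.exp (e * X x)) μ :=
    integrable_of_measurable_of_abs_le (by fun_prop) (C := Real.exp (e * C)) fun x => by
      rw [abs_of_pos (Real.exp_pos _)]
      exact Real.exp_le_exp.2 ((le_abs_self _).trans (hb x))
  have i2 : Integrable X μ := integrable_of_measurable_of_abs_le hX hC
  have i3 : Integrable (fun x => X x ^ 2) μ :=
    integrable_of_measurable_of_abs_le (by fun_prop) (C := C ^ 2) fun x => by
      rw [abs_pow]; exact pow_le_pow_left₀ (abs_nonneg _) (hC x) 2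
  have e1 : ∫ x, Real.exp (e * X x) ∂μ - 1 - e ^ 2 / 2 * ∫ x, X x ^ 2 ∂μ =
      ∫ x, (Real.exp (e * X x) - (1 + e * X x + e ^ 2 / 2 * X x ^ 2)) ∂μ := by
    have i4 : Integrable (fun x => 1 + e * X x) μ := (integrable_const _).add (i2.const_mul e)
    have i5 : Integrable (fun x => e ^ 2 / 2 * X x ^ 2) μ := i3.const_mul _
    have i6 : Integrable (fun x => 1 + e * X x + e ^ 2 / 2 * X x ^ 2) μ := i4.add i5
    rw [integral_sub i1 i6, integral_add i4 i5,
      integral_add (integrable_const _) (i2.const_mul e), integral_const_mul, integral_const_mul,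
      hX0]
    simp
    ring
  rw [e1, ← Real.norm_eq_abs]
  refine (norm_integral_le_of_norm_le_const (C := (e * C) ^ 3) (.of_forall fun x => ?_)).trans
    (by simp)
  have h := Real.exp_bound ((hb x).trans heC) (n := 3) (by norm_num)
  simp only [Finset.sum_range_succ, Finset.sum_range_zero, Nat.factorial] at h
  norm_num at h
  rw [← abs_mul] at h
  rw [Real.norm_eq_abs]
  have h2 : |e * X x| ^ 3 ≤ (e * C) ^ 3 := pow_le_pow_left₀ (abs_nonneg _) (hb x) 3
  have h3 : 0 ≤ |e * X x| ^ 3 := by positivity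
  have h4 : 1 + e * X x + e ^ 2 / 2 * X x ^ 2 = 1 + e * X x + (e * X x) ^ 2 / 2 := by ring
  rw [h4]
  refine h.trans ?_
  linarith

theorem tendsto_integral_exp_sub_one_div_sq {α : Type*} [MeasurableSpace α] {μ : Measure α}
    [IsProbabilityMeasure μ] {X : α → ℝ} (hX : Measurable X) {C : ℝ} (hC : ∀ x, |X x| ≤ C)
    (hX0 : ∫ x, X x ∂μ = 0) :
    Filter.Tendsto (fun e : ℝ => (∫ x, Real.exp (e * X x) ∂μ - 1) / e ^ 2)
      (nhdsWithin 0 (Set.Ioi 0)) (nhds ((∫ x, X x ^ 2 ∂μ) / 2)) := by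
  have h0 : Filter.Tendsto (fun e : ℝ => e * |C| ^ 3) (nhdsWithin 0 (Set.Ioi 0)) (nhds 0) := by
    refine Filter.Tendsto.mono_left ?_ nhdsWithin_le_nhds
    have : Continuous fun e : ℝ => e * |C| ^ 3 := by fun_prop
    simpa using this.tendsto 0
  rw [tendsto_iff_norm_sub_tendsto_zero]
  refine squeeze_zero' (.of_forall fun _ => norm_nonneg _) ?_ h0
  have hpos : (0 : ℝ) < (|C| + 1)⁻¹ := by positivity
  filter_upwards [Ioo_mem_nhdsGT hpos] with e he
  have heC : e * |C| ≤ 1 := by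
    have h1 := mul_le_mul_of_nonneg_right he.2.le (by positivity : 0 ≤ |C| + 1)
    rw [inv_mul_cancel₀ (by positivity)] at h1
    linarith [he.1]
  have := abs_integral_exp_sub_le (μ := μ) hX (fun x => (hC x).trans (le_abs_self C)) hX0 he.1.le
    heC
  have he2 : 0 < e ^ 2 := pow_pos he.1 2
  have e1 : (∫ x, Real.exp (e * X x) ∂μ - 1) / e ^ 2 - (∫ x, X x ^ 2 ∂μ) / 2 =
      (∫ x, Real.exp (e * X x) ∂μ - 1 - e ^ 2 / 2 * ∫ x, X x ^ 2 ∂μ) / e ^ 2 := by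
    have := he.1.ne'
    field_simp
  rw [e1, Real.norm_eq_abs, abs_div, abs_of_pos he2, div_le_iff₀ he2]
  calc _ ≤ _ := this
    _ = _ := by ring

/-- The second-order consequence of an exponential-moment inequality of Loomis–Whitney type. -/
theorem integral_sum_sq_le_of_lintegral_exp_le {α κ : Type*} [MeasurableSpace α] [Fintype κ]
    {μ : Measure α} [IsProbabilityMeasure μ] {a : κ → α → ℝ} (ha : ∀ m, Measurable (a m)) {C : ℝ}
    (hC : ∀ m x, |a m x| ≤ C) (ha0 : ∀ m, ∫ x, a m x ∂μ = 0) {q : ℝ} (hq : 0 < q)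
    (H : ∀ e : ℝ, (∫⁻ x, ENNReal.ofReal (Real.exp (q⁻¹ * ∑ m, e * a m x)) ∂μ) ^ q ≤
      ∏ m, ∫⁻ x, ENNReal.ofReal (Real.exp (e * a m x)) ∂μ) :
    ∫ x, (∑ m, a m x) ^ 2 ∂μ ≤ q * ∑ m, ∫ x, a m x ^ 2 ∂μ := by
  set S : α → ℝ := fun x => q⁻¹ * ∑ m, a m x with hS
  have hSm : Measurable S := by fun_prop
  have hSC : ∀ x, |S x| ≤ q⁻¹ * ∑ _m : κ, C := fun x => by
    rw [hS, abs_mul, abs_of_pos (inv_pos.2 hq)]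
    gcongr
    exact (Finset.abs_sum_le_sum_abs _ _).trans (Finset.sum_le_sum fun m _ => hC m x)
  have hS0 : ∫ x, S x ∂μ = 0 := by
    rw [hS, integral_const_mul, integral_finsetSum _ fun m _ =>
      integrable_of_measurable_of_abs_le (ha m) (hC m)]
    simp [ha0]
  have hexp : ∀ {X : α → ℝ} {K : ℝ}, Measurable X → (∀ x, |X x| ≤ K) → ∀ e : ℝ,
      Integrable (fun x => Real.exp (e * X x)) μ := by
    intro X K hX hK e
    refine integrable_of_measurable_of_abs_le (by fun_prop) (C := Real.exp (|e| * K)) fun x => ?_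
    rw [abs_of_pos (Real.exp_pos _)]
    refine Real.exp_le_exp.2 ((le_abs_self _).trans ?_)
    rw [abs_mul]
    exact mul_le_mul_of_nonneg_left (hK x) (abs_nonneg _)
  have hpos : ∀ {X : α → ℝ} {K : ℝ}, Measurable X → (∀ x, |X x| ≤ K) → ∀ e : ℝ,
      0 < ∫ x, Real.exp (e * X x) ∂μ := fun hX hK e => integral_exp_pos (hexp hX hK e)
  have hlog : ∀ e : ℝ, q * Real.log (∫ x, Real.exp (e * S x) ∂μ) ≤
      ∑ m, Real.log (∫ x, Real.exp (e * a m x) ∂μ) := by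
    intro e
    have h := H e
    have e1 : ∀ x, q⁻¹ * ∑ m, e * a m x = e * S x := fun x => by
      simp only [hS, ← Finset.mul_sum]; ring
    simp only [e1] at h
    rw [← ofReal_integral_eq_lintegral_ofReal (hexp hSm hSC e)
      (.of_forall fun x => (Real.exp_pos _).le),
      Finset.prod_congr rfl fun m _ => (ofReal_integral_eq_lintegral_ofReal (hexp (ha m) (hC m) e)
      (.of_forall fun x => (Real.exp_pos _).le)).symm,
      ENNReal.ofReal_rpow_of_pos (hpos hSm hSC e),
      ← ENNReal.ofReal_prod_of_nonneg fun m _ => (hpos (ha m) (hC m) e).le,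
      ENNReal.ofReal_le_ofReal_iff (Finset.prod_nonneg fun m _ => (hpos (ha m) (hC m) e).le)] at h
    have := Real.log_le_log (Real.rpow_pos_of_pos (hpos hSm hSC e) q) h
    rwa [Real.log_rpow (hpos hSm hSC e),
      Real.log_prod fun m _ => (hpos (ha m) (hC m) e).ne'] at this
  -- The bounds `1 - 1/z ≤ log z ≤ z - 1` suffice in place of an expansion of the logarithm: each is
  -- exact to second order in `e`, as the variables are centred and `z - 1` is itself of order `e²`.
  have hineq : ∀ e : ℝ, 0 < e → q * ((∫ x, Real.exp (e * S x) ∂μ - 1) / e ^ 2 /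
      ∫ x, Real.exp (e * S x) ∂μ) ≤ ∑ m, (∫ x, Real.exp (e * a m x) ∂μ - 1) / e ^ 2 := by
    intro e he
    have h1 := Real.one_sub_inv_le_log_of_pos (hpos hSm hSC e)
    have h2 := mul_le_mul_of_nonneg_left h1 hq.le
    have h3 : ∑ m, Real.log (∫ x, Real.exp (e * a m x) ∂μ) ≤
        ∑ m, (∫ x, Real.exp (e * a m x) ∂μ - 1) :=
      Finset.sum_le_sum fun m _ => Real.log_le_sub_one_of_pos (hpos (ha m) (hC m) e)
    have h4 := (h2.trans (hlog e)).trans h3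
    rw [← Finset.sum_div, le_div_iff₀ (pow_pos he 2)]
    refine le_trans (le_of_eq ?_) h4
    have := (hpos hSm hSC e).ne'
    have := he.ne'
    field_simp
  have l1 := tendsto_integral_exp_sub_one_div_sq (μ := μ) hSm hSC hS0
  have l2 : Filter.Tendsto (fun e : ℝ => ∫ x, Real.exp (e * S x) ∂μ)
      (nhdsWithin 0 (Set.Ioi 0)) (nhds 1) := by
    have hsq : Filter.Tendsto (fun e : ℝ => e ^ 2) (nhdsWithin 0 (Set.Ioi 0)) (nhds 0) := by
      refine Filter.Tendsto.mono_left ?_ nhdsWithin_le_nhds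
      simpa using (continuous_pow 2).tendsto (0 : ℝ)
    have := (l1.mul hsq).add_const 1
    simp only [mul_zero, zero_add] at this
    refine this.congr' ?_
    filter_upwards [self_mem_nhdsWithin] with e he
    rw [div_mul_cancel₀ _ (pow_ne_zero 2 (ne_of_gt he))]
    ring
  have l3 := tendsto_finsetSum Finset.univ fun m (_ : m ∈ Finset.univ) =>
    tendsto_integral_exp_sub_one_div_sq (μ := μ) (ha m) (hC m) (ha0 m)
  have l4 := le_of_tendsto_of_tendsto ((l1.div l2 one_ne_zero).const_mul q) l3 (by
    filter_upwards [self_mem_nhdsWithin] with e he using hineq e he)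
  rw [div_one, ← Finset.sum_div] at l4
  have e2 : ∫ x, S x ^ 2 ∂μ = q⁻¹ ^ 2 * ∫ x, (∑ m, a m x) ^ 2 ∂μ := by
    rw [← integral_const_mul]
    simp only [hS, mul_pow]
  rw [e2] at l4
  have e3 : q * (q⁻¹ ^ 2 * ∫ x, (∑ m, a m x) ^ 2 ∂μ) = (∫ x, (∑ m, a m x) ^ 2 ∂μ) / q := by
    field_simp
  rw [mul_div_assoc', e3, div_le_div_iff_of_pos_right two_pos, div_le_iff₀ hq] at l4
  linarith

/-! ### Dirichlet forms as jump energies -/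

/-- Twice the Dirichlet form, `∬ (f x - f y)² P(x, dy) ν(dx)`. -/
noncomputable def jumpEnergy {α : Type*} [MeasurableSpace α] (ν : Measure α) (P : Kernel α α)
    (f : α → ℝ) : ℝ≥0∞ :=
  ∫⁻ x, ∫⁻ y, ENNReal.ofReal ((f x - f y) ^ 2) ∂(P x) ∂ν

/-- Invariance is needed because the inner integral could otherwise charge a `ν`-null set. This
permits passing to a measurable representative. -/
theorem dirichletForm_congr_ae {α : Type*} [MeasurableSpace α] {ν : Measure α} {P : Kernel α α}
    (hP : P.Invariant ν) {f g : α → ℝ} (h : f =ᵐ[ν] g) :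
    dirichletForm ν P f = dirichletForm ν P g := by
  have h2 : ∀ᵐ x ∂ν, ∀ᵐ y ∂(P x), f y = g y := by
    have : ∀ᵐ y ∂(ν.bind P), f y = g y := by rw [hP.def]; exact h
    exact Measure.ae_ae_of_ae_bind P.aemeasurable this
  refine integral_congr_ae ?_
  filter_upwards [h, h2] with x hx hx2
  rw [hx, integral_congr_ae hx2]

section

variable {α : Type*} [MeasurableSpace α] {ν : Measure α} [IsProbabilityMeasure ν]
  {P : Kernel α α} [IsMarkovKernel P] {f : α → ℝ}

theorem MeasureTheory.MemLp.compProd_fst (hL : MemLp f 2 ν) :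
    MemLp (fun p : α × α => f p.1) 2 (ν ⊗ₘ P) :=
  hL.comp_measurePreserving ⟨measurable_fst, Measure.fst_compProd ν P⟩

theorem MeasureTheory.MemLp.compProd_snd (hP : P.Invariant ν) (hL : MemLp f 2 ν) :
    MemLp (fun p : α × α => f p.2) 2 (ν ⊗ₘ P) :=
  hL.comp_measurePreserving ⟨measurable_snd, (Measure.snd_compProd ν P).trans hP⟩

theorem ae_integrable_of_memLp (hP : P.Invariant ν) (hL : MemLp f 2 ν) :
    ∀ᵐ x ∂ν, Integrable f (P x) := by
  have h := (hL.compProd_snd hP).integrable one_le_two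
  exact ((Measure.integrable_compProd_iff h.aestronglyMeasurable).1 h).1

theorem dirichletForm_eq_integral_compProd (hP : P.Invariant ν) (hL : MemLp f 2 ν) :
    dirichletForm ν P f = ∫ p, f p.1 * (f p.1 - f p.2) ∂(ν ⊗ₘ P) := by
  have h1 : MemLp (fun p : α × α => f p.1) 2 (ν ⊗ₘ P) := hL.compProd_fst
  have h2 := hL.compProd_snd hP
  have hint : Integrable (fun p : α × α => f p.1 * (f p.1 - f p.2)) (ν ⊗ₘ P) :=
    h1.integrable_mul (h1.sub h2)
  rw [Measure.integral_compProd hint, dirichletForm]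
  refine integral_congr_ae ?_
  filter_upwards [ae_integrable_of_memLp hP hL] with x hx
  rw [integral_const_mul, integral_sub (integrable_const _) hx]
  simp

/-- Invariance alone suffices: `2a(a - b) - (a - b)² = a² - b²`, and the two marginals of `ν ⊗ₘ P`
coincide. In `ℝ≥0∞` the energies can then be disintegrated and compared without integrability side
conditions. -/
theorem ofReal_two_mul_dirichletForm (hP : P.Invariant ν) (hf : Measurable f)
    (hL : MemLp f 2 ν) :
    0 ≤ dirichletForm ν P f ∧
      ENNReal.ofReal (2 * dirichletForm ν P f) = jumpEnergy ν P f := by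
  have h1 : MemLp (fun p : α × α => f p.1) 2 (ν ⊗ₘ P) := hL.compProd_fst
  have h2 := hL.compProd_snd hP
  have hint : Integrable (fun p : α × α => f p.1 * (f p.1 - f p.2)) (ν ⊗ₘ P) :=
    h1.integrable_mul (h1.sub h2)
  have hsq : Integrable (fun p : α × α => (f p.1 - f p.2) ^ 2) (ν ⊗ₘ P) :=
    (h1.sub h2).integrable_sq
  have e0 : ∫ p, f p.1 ^ 2 ∂(ν ⊗ₘ P) = ∫ p, f p.2 ^ 2 ∂(ν ⊗ₘ P) := by
    have a1 : ∫ x, f x ^ 2 ∂((ν ⊗ₘ P).map Prod.fst) = ∫ p, f p.1 ^ 2 ∂(ν ⊗ₘ P) :=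
      integral_map measurable_fst.aemeasurable (hf.pow_const 2).aestronglyMeasurable
    have a2 : ∫ x, f x ^ 2 ∂((ν ⊗ₘ P).map Prod.snd) = ∫ p, f p.2 ^ 2 ∂(ν ⊗ₘ P) :=
      integral_map measurable_snd.aemeasurable (hf.pow_const 2).aestronglyMeasurable
    rw [← a1, ← a2]
    congr 1
    exact (Measure.fst_compProd ν P).trans ((Measure.snd_compProd ν P).trans hP).symm
  have e1 : 2 * dirichletForm ν P f = ∫ p, (f p.1 - f p.2) ^ 2 ∂(ν ⊗ₘ P) := by
    rw [dirichletForm_eq_integral_compProd hP hL, ← integral_const_mul, ← sub_eq_zero,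
      ← integral_sub (hint.const_mul 2) hsq, ← sub_eq_zero.2 e0,
      ← integral_sub h1.integrable_sq h2.integrable_sq]
    refine integral_congr_ae (.of_forall fun p => ?_)
    ring
  have e2 : 0 ≤ 2 * dirichletForm ν P f := by
    rw [e1]; exact integral_nonneg fun p => sq_nonneg _
  refine ⟨by linarith, ?_⟩
  rw [e1, ofReal_integral_eq_lintegral_ofReal hsq (.of_forall fun p => sq_nonneg _),
    Measure.lintegral_compProd (by fun_prop), jumpEnergy]

theorem invariant_const : (Kernel.const α ν).Invariant ν := by
  simp [Kernel.Invariant]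

/-- Treating the variance as the Dirichlet form of independent resampling turns every gap bound into
a comparison of two jump energies. -/
theorem dirichletForm_const (hL : MemLp f 2 ν) :
    dirichletForm ν (Kernel.const α ν) f = variance f ν := by
  rw [variance_eq_sub hL, dirichletForm]
  simp only [Kernel.const_apply, mul_sub]
  have hff : Integrable (fun x => f x * f x) ν := hL.integrable_mul hL
  rw [integral_sub hff ((hL.integrable one_le_two).mul_const _),
    integral_mul_const]
  simp [sq]

theorem ofReal_two_mul_variance (hf : Measurable f) (hL : MemLp f 2 ν) :
    ENNReal.ofReal (2 * variance f ν) = jumpEnergy ν (Kernel.const α ν) f := by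
  rw [← dirichletForm_const hL]
  exact (ofReal_two_mul_dirichletForm invariant_const hf hL).2

theorem ofReal_mul_jumpEnergy_le_of_le_spectralGap (hP : P.Invariant ν) (hf : Measurable f)
    (hL : MemLp f 2 ν) {β : ℝ} (hβ : (β : EReal) ≤ spectralGap ν P) :
    ENNReal.ofReal β * jumpEnergy ν (Kernel.const α ν) f ≤ jumpEnergy ν P f := by
  obtain ⟨h0, h1⟩ := ofReal_two_mul_dirichletForm hP hf hL
  rw [← h1, ← ofReal_two_mul_variance hf hL, ← ENNReal.ofReal_mul' (by positivity [variance_nonneg f ν])]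
  refine ENNReal.ofReal_le_ofReal ?_
  -- The infimum defining the gap says nothing at zero variance; there nonnegativity of the
  -- Dirichlet form is enough.
  by_cases hv : variance f ν = 0
  · simp [hv, h0]
  · have h2 : (β : EReal) ≤ ((dirichletForm ν P f / variance f ν : ℝ) : EReal) :=
      hβ.trans (iInf_le_of_le f (iInf_le_of_le hL (iInf_le _ hv)))
    have h3 := EReal.coe_le_coe_iff.1 h2
    rw [le_div_iff₀ (lt_of_le_of_ne (variance_nonneg f ν) (Ne.symm hv))] at h3
    linarith

end

/-! ### Disintegration of the Gibbs measure along one block -/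

section Disintegration

variable {M : ℕ} {d : Fin M → ℕ}

theorem measurable_replaceBlock_uncurry (m : Fin M) :
    Measurable fun p : BlockSpace d × EuclideanSpace ℝ (Fin (d m)) => replaceBlock m p.1 p.2 :=
  measurable_update'

theorem continuous_replaceBlock_uncurry (m : Fin M) :
    Continuous fun p : BlockSpace d × EuclideanSpace ℝ (Fin (d m)) => replaceBlock m p.1 p.2 :=
  continuous_fst.update m continuous_snd

@[simp] theorem replaceBlock_replaceBlock (m : Fin M) (x : BlockSpace d)
    (y z : EuclideanSpace ℝ (Fin (d m))) :
    replaceBlock m (replaceBlock m x y) z = replaceBlock m x z :=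
  Function.update_idem _ _ _

@[simp] theorem replaceBlock_same (m : Fin M) (x : BlockSpace d)
    (y : EuclideanSpace ℝ (Fin (d m))) : replaceBlock m x y m = y :=
  Function.update_self _ _ _

@[simp] theorem replaceBlock_apply_self (m : Fin M) (x : BlockSpace d) :
    replaceBlock m x (x m) = x :=
  Function.update_eq_self _ _

/-- Exchanging the `m`-th block of `x` with `y` preserves `dx dy`. -/
theorem lintegral_lintegral_swap_block (m : Fin M)
    {H : BlockSpace d → EuclideanSpace ℝ (Fin (d m)) → ℝ≥0∞}
    (hH : Measurable (Function.uncurry H)) :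
    ∫⁻ x, ∫⁻ y, H x y = ∫⁻ x : BlockSpace d, ∫⁻ y, H (replaceBlock m x y) (x m) := by
  have hH2 : Measurable fun p : BlockSpace d × EuclideanSpace ℝ (Fin (d m)) =>
      H (replaceBlock m p.1 p.2) (p.1 m) :=
    hH.comp ((measurable_replaceBlock_uncurry m).prodMk ((measurable_pi_apply m).comp measurable_fst))
  rw [volume_pi]
  refine lintegral_eq_of_lmarginal_eq {m} hH.lintegral_prod_right hH2.lintegral_prod_right ?_
  rw [lmarginal_singleton, lmarginal_singleton]
  funext x
  change ∫⁻ z, ∫⁻ y, H (replaceBlock m x z) y = ∫⁻ z, ∫⁻ y,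
    H (replaceBlock m (replaceBlock m x z) y) (replaceBlock m x z m)
  simp only [replaceBlock_replaceBlock, replaceBlock_same]
  rw [lintegral_lintegral_swap]
  · exact (hH.comp (((measurable_replaceBlock m x).comp measurable_fst).prodMk
      measurable_snd)).aemeasurable

/-- The normalizing constant `∫ exp (-U(y, x_{-m})) dy`. -/
noncomputable def sliceMass (U : BlockSpace d → ℝ) (m : Fin M) (x : BlockSpace d) : ℝ≥0∞ :=
  ∫⁻ y, ENNReal.ofReal (Real.exp (-U (replaceBlock m x y)))

variable {U : BlockSpace d → ℝ}

theorem sliceMass_eq (U : BlockSpace d → ℝ) (m : Fin M) (x : BlockSpace d) :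
    blockSliceMeasure U m x Set.univ = sliceMass U m x := by
  simp [blockSliceMeasure, sliceMass]

theorem measurable_density_uncurry (hU : Continuous U) (m : Fin M) :
    Measurable fun p : BlockSpace d × EuclideanSpace ℝ (Fin (d m)) =>
      ENNReal.ofReal (Real.exp (-U (replaceBlock m p.1 p.2))) := by
  have := hU.comp (continuous_replaceBlock_uncurry (d := d) m)
  exact (ENNReal.continuous_ofReal.comp (Real.continuous_exp.comp this.neg)).measurable

theorem measurable_density (hU : Continuous U) (m : Fin M) (x : BlockSpace d) :
    Measurable fun y => ENNReal.ofReal (Real.exp (-U (replaceBlock m x y))) :=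
  (measurable_density_uncurry hU m).comp measurable_prodMk_left

theorem measurable_sliceMass (hU : Continuous U) (m : Fin M) : Measurable (sliceMass U m) :=
  (measurable_density_uncurry hU m).lintegral_prod_right

@[simp] theorem sliceMass_replaceBlock (m : Fin M) (x : BlockSpace d)
    (y : EuclideanSpace ℝ (Fin (d m))) :
    sliceMass U m (replaceBlock m x y) = sliceMass U m x := by
  simp [sliceMass]

theorem sliceMass_ne_zero (hU : Continuous U) (m : Fin M) (x : BlockSpace d) :
    sliceMass U m x ≠ 0 := by
  intro h
  rw [sliceMass, lintegral_eq_zero_iff (measurable_density hU m x)] at h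
  have h2 : ∀ᵐ y ∂(volume : Measure (EuclideanSpace ℝ (Fin (d m)))), False := by
    filter_upwards [h] with y hy
    have := Real.exp_pos (-U (replaceBlock m x y))
    simp only [Pi.zero_apply, ENNReal.ofReal_eq_zero] at hy
    linarith
  rw [Filter.eventually_false_iff_eq_bot, ae_eq_bot] at h2
  exact NeZero.ne _ h2

/-- Weight the new block by a positive density `v` of total mass below 1. Exchanging blocks
identifies a finite integral with one of `sliceMass * v` over the set `B` where the slice mass is
infinite, so `B` is null. -/
theorem ae_sliceMass_ne_top (hU : Continuous U) [IsProbabilityMeasure (gibbsMeasure U)]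
    (m : Fin M) : ∀ᵐ x, sliceMass U m x ≠ ∞ := by
  obtain ⟨v, hv0, hvm, hv1⟩ := exists_pos_lintegral_lt_of_sigmaFinite
    (volume : Measure (EuclideanSpace ℝ (Fin (d m)))) one_ne_zero
  set w : BlockSpace d → ℝ≥0∞ := fun x => ENNReal.ofReal (Real.exp (-U x)) with hw
  have hwm : Measurable w := by have := hU.measurable; fun_prop
  have hw1 : ∫⁻ x, w x = 1 := by
    have h := lintegral_gibbsMeasure hU (f := fun _ => 1) measurable_const
    simpa using h.symm
  set B : Set (BlockSpace d) := {x | sliceMass U m x = ∞} with hB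
  have hBm : MeasurableSet B := measurable_sliceMass hU m (measurableSet_singleton _)
  set b : BlockSpace d → ℝ≥0∞ := B.indicator 1 with hb
  have hbm : Measurable b := measurable_one.indicator hBm
  have hbr : ∀ x y, b (replaceBlock m x y) = b x := fun x y => by
    simp [hb, hB, Set.indicator_apply]
  have h := lintegral_lintegral_swap_block m (H := fun x y => w x * b x * v y) (by
    exact ((hwm.mul hbm).comp measurable_fst).mul (hvm.coe_nnreal_ennreal.comp measurable_snd))
  have hL : ∫⁻ x, ∫⁻ y, w x * b x * v y ≠ ∞ := by
    refine ne_top_of_le_ne_top ENNReal.one_ne_top ?_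
    rw [← hw1]
    refine lintegral_mono fun x => ?_
    rw [lintegral_const_mul _ hvm.coe_nnreal_ennreal]
    have : b x ≤ 1 := Set.indicator_le_self' (fun _ _ => zero_le_one) x
    calc w x * b x * ∫⁻ y, (v y : ℝ≥0∞) ≤ w x * 1 * 1 := by gcongr
      _ = w x := by simp
  have hR : ∀ x, ∫⁻ y, w (replaceBlock m x y) * b (replaceBlock m x y) * v (x m) =
      sliceMass U m x * (b x * v (x m)) := by
    intro x
    simp only [hbr, mul_assoc]
    rw [lintegral_mul_const _ (measurable_density hU m x)]
    rfl
  rw [h, lintegral_congr hR] at hL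
  have hm2 : Measurable fun x : BlockSpace d => sliceMass U m x * (b x * v (x m)) :=
    (measurable_sliceMass hU m).mul (hbm.mul (hvm.coe_nnreal_ennreal.comp (measurable_pi_apply m)))
  filter_upwards [ae_lt_top hm2 hL] with x hx hxt
  have hbx : b x = 1 := by simp [hb, hB, hxt]
  rw [hxt, hbx, one_mul, ENNReal.top_mul (by simpa using (hv0 (x m)).ne')] at hx
  exact lt_irrefl _ hx

open Classical in
/-- A version of the full conditional of the `m`-th block that is a Markov kernel. -/
noncomputable def gibbsConditional (hU : Continuous U) (m : Fin M) :
    Kernel (BlockSpace d) (EuclideanSpace ℝ (Fin (d m))) :=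
  Kernel.piecewise (s := sliceMass U m ⁻¹' {∞})
    (measurable_sliceMass hU m (measurableSet_singleton _))
    (Kernel.const _ (Measure.dirac 0))
    (Kernel.withDensity (Kernel.const _ volume) fun x y =>
      (sliceMass U m x)⁻¹ * ENNReal.ofReal (Real.exp (-U (replaceBlock m x y))))

open Classical in
theorem gibbsConditional_apply (hU : Continuous U) (m : Fin M) {x : BlockSpace d}
    (hx : sliceMass U m x ≠ ∞) : gibbsConditional hU m x = fullConditional U m x := by
  have h1 : gibbsConditional hU m x = (Kernel.withDensity (Kernel.const _ volume) fun x y =>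
      (sliceMass U m x)⁻¹ * ENNReal.ofReal (Real.exp (-U (replaceBlock m x y)))) x := by
    rw [gibbsConditional, Kernel.piecewise_apply, if_neg (by simpa using hx)]
  rw [h1, Kernel.withDensity_apply, fullConditional, sliceMass_eq, blockSliceMeasure,
    Kernel.const_apply]
  · exact withDensity_smul _ (measurable_density hU m x)
  · exact ((measurable_sliceMass hU m).inv.comp measurable_fst).mul
      (measurable_density_uncurry hU m)

open Classical in
theorem gibbsConditional_apply_top (hU : Continuous U) (m : Fin M) {x : BlockSpace d}
    (hx : sliceMass U m x = ∞) : gibbsConditional hU m x = Measure.dirac 0 := by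
  rw [gibbsConditional, Kernel.piecewise_apply, if_pos (by simpa using hx), Kernel.const_apply]

theorem lintegral_gibbsConditional (hU : Continuous U) (m : Fin M) {x : BlockSpace d}
    (hx : sliceMass U m x ≠ ∞) {f : EuclideanSpace ℝ (Fin (d m)) → ℝ≥0∞} (hf : Measurable f) :
    ∫⁻ y, f y ∂gibbsConditional hU m x = (sliceMass U m x)⁻¹ *
      ∫⁻ y, ENNReal.ofReal (Real.exp (-U (replaceBlock m x y))) * f y := by
  rw [gibbsConditional_apply hU m hx, fullConditional, sliceMass_eq, lintegral_smul_measure,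
    blockSliceMeasure, lintegral_withDensity_eq_lintegral_mul _
      (measurable_density hU m x) hf]
  rfl

instance (hU : Continuous U) (m : Fin M) : IsMarkovKernel (gibbsConditional hU m) := by
  refine ⟨fun x => ?_⟩
  by_cases hx : sliceMass U m x = ∞
  · rw [gibbsConditional_apply_top hU m hx]; infer_instance
  · refine ⟨?_⟩
    rw [gibbsConditional_apply hU m hx, fullConditional, sliceMass_eq, Measure.smul_apply,
      sliceMass_eq, smul_eq_mul, ENNReal.inv_mul_cancel (sliceMass_ne_zero hU m x) hx]

theorem gibbsConditional_replaceBlock (hU : Continuous U) (m : Fin M) (x : BlockSpace d)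
    (y : EuclideanSpace ℝ (Fin (d m))) :
    gibbsConditional hU m (replaceBlock m x y) = gibbsConditional hU m x := by
  by_cases hx : sliceMass U m x = ∞
  · rw [gibbsConditional_apply_top hU m hx, gibbsConditional_apply_top hU m (by simpa using hx)]
  · rw [gibbsConditional_apply hU m hx, gibbsConditional_apply hU m (by simpa using hx)]
    simp [fullConditional, blockSliceMeasure]

theorem gibbsMeasure_absolutelyContinuous (U : BlockSpace d → ℝ) :
    gibbsMeasure U ≪ volume :=
  withDensity_absolutelyContinuous _ _

/-- Drawing `y` from the full conditional and exchanging it with `x_m` preserves the joint law. -/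
theorem lintegral_gibbsConditional_swap (hU : Continuous U)
    [IsProbabilityMeasure (gibbsMeasure U)] (m : Fin M)
    {H : BlockSpace d → EuclideanSpace ℝ (Fin (d m)) → ℝ≥0∞}
    (hH : Measurable (Function.uncurry H)) :
    ∫⁻ x, ∫⁻ y, H x y ∂gibbsConditional hU m x ∂gibbsMeasure U =
      ∫⁻ x, ∫⁻ y, H (replaceBlock m x y) (x m) ∂gibbsConditional hU m x ∂gibbsMeasure U := by
  have main : ∀ {K : BlockSpace d → EuclideanSpace ℝ (Fin (d m)) → ℝ≥0∞},
      Measurable (Function.uncurry K) →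
      ∫⁻ x, ∫⁻ y, K x y ∂gibbsConditional hU m x ∂gibbsMeasure U =
      ∫⁻ x, ∫⁻ y, ENNReal.ofReal (Real.exp (-U x)) * ((sliceMass U m x)⁻¹ *
        (ENNReal.ofReal (Real.exp (-U (replaceBlock m x y))) * K x y)) := by
    intro K hK
    rw [lintegral_gibbsMeasure hU (hK.lintegral_kernel_prod_right)]
    refine lintegral_congr_ae ?_
    filter_upwards [ae_sliceMass_ne_top hU m] with x hx
    have hKx : Measurable (K x) := hK.comp measurable_prodMk_left
    have hd : Measurable fun y => ENNReal.ofReal (Real.exp (-U (replaceBlock m x y))) * K x y :=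
      (measurable_density hU m x).mul hKx
    rw [lintegral_gibbsConditional hU m hx hKx,
      lintegral_const_mul _ (hd.const_mul _), lintegral_const_mul _ hd]
  have hH2 : Measurable (Function.uncurry fun (x : BlockSpace d) y =>
      H (replaceBlock m x y) (x m)) :=
    hH.comp ((measurable_replaceBlock_uncurry m).prodMk ((measurable_pi_apply m).comp measurable_fst))
  -- The joint density `exp (-U(x)) exp (-U(y, x_{-m})) / Z(x_{-m})` is symmetric in `x_m` and `y`.
  rw [main hH, main hH2, lintegral_lintegral_swap_block]
  · refine lintegral_congr fun x => lintegral_congr fun y => ?_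
    simp only [replaceBlock_replaceBlock, sliceMass_replaceBlock, replaceBlock_apply_self]
    ring
  · have hw : Measurable fun x : BlockSpace d => ENNReal.ofReal (Real.exp (-U x)) := by
      have := hU.measurable; fun_prop
    exact (hw.comp measurable_fst).mul (((measurable_sliceMass hU m).inv.comp measurable_fst).mul
      ((measurable_density_uncurry hU m).mul hH))

end Disintegration

/-! ### Block kernels, invariance and comparison with exact Gibbs updates -/

section Kernels

variable {M : ℕ} {d : Fin M → ℕ}

theorem blockKernel_apply (m : Fin M)
    (Q : Kernel (BlockSpace d) (EuclideanSpace ℝ (Fin (d m)))) [IsMarkovKernel Q]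
    (x : BlockSpace d) : blockKernel m Q x = (Q x).map (replaceBlock m x) := by
  refine Measure.ext_of_lintegral _ fun f hf => ?_
  have hc : Measurable fun p : BlockSpace d × EuclideanSpace ℝ (Fin (d m)) =>
      f (replaceBlock m p.1 p.2) := hf.comp (measurable_replaceBlock_uncurry m)
  rw [blockKernel, Kernel.lintegral_map _ (measurable_replaceBlock_uncurry m) _ hf,
    Kernel.lintegral_id_prod hc,
    lintegral_map hf (measurable_replaceBlock m x)]

theorem lintegral_blockKernel (m : Fin M)
    (Q : Kernel (BlockSpace d) (EuclideanSpace ℝ (Fin (d m)))) [IsMarkovKernel Q]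
    (x : BlockSpace d) {f : BlockSpace d → ℝ≥0∞} (hf : Measurable f) :
    ∫⁻ y, f y ∂blockKernel m Q x = ∫⁻ y, f (replaceBlock m x y) ∂Q x := by
  rw [blockKernel_apply, lintegral_map hf (measurable_replaceBlock m x)]

instance (m : Fin M) (Q : Kernel (BlockSpace d) (EuclideanSpace ℝ (Fin (d m))))
    [IsMarkovKernel Q] : IsMarkovKernel (blockKernel m Q) :=
  Kernel.IsMarkovKernel.map _ (measurable_replaceBlock_uncurry m)

instance (m : Fin M) (Q : Kernel (BlockSpace d) (EuclideanSpace ℝ (Fin (d m))))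
    [IsMarkovKernel Q] (x : BlockSpace d) : IsMarkovKernel (conditionalUpdate m Q x) :=
  Kernel.IsMarkovKernel.comap _ (measurable_replaceBlock m x)

theorem lintegral_metropolisWithinGibbs
    (Q : ∀ m : Fin M, Kernel (BlockSpace d) (EuclideanSpace ℝ (Fin (d m))))
    (x : BlockSpace d) (f : BlockSpace d → ℝ≥0∞) :
    ∫⁻ y, f y ∂metropolisWithinGibbs Q x =
      (M : ℝ≥0∞)⁻¹ * ∑ m, ∫⁻ y, f y ∂blockKernel m (Q m) x := by
  change ∫⁻ y, f y ∂((M : ℝ≥0∞)⁻¹ • ∑ m, blockKernel m (Q m) x) = _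
  rw [lintegral_smul_measure, lintegral_finsetSum_measure, smul_eq_mul]

theorem isMarkovKernel_metropolisWithinGibbs (hM : 0 < M)
    (Q : ∀ m : Fin M, Kernel (BlockSpace d) (EuclideanSpace ℝ (Fin (d m))))
    (hQ : ∀ m, IsMarkovKernel (Q m)) : IsMarkovKernel (metropolisWithinGibbs Q) := by
  refine ⟨fun x => ⟨?_⟩⟩
  have h := lintegral_metropolisWithinGibbs Q x (fun _ => 1)
  simp only [lintegral_const, one_mul, measure_univ, Finset.sum_const, Finset.card_univ,
    Fintype.card_fin, nsmul_eq_mul, mul_one] at h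
  rw [h, ENNReal.inv_mul_cancel (by simpa using hM.ne') (by simp)]

theorem invariant_of_lintegral {α : Type*} [MeasurableSpace α] {ν : Measure α} {P : Kernel α α}
    (h : ∀ f : α → ℝ≥0∞, Measurable f → ∫⁻ x, ∫⁻ y, f y ∂P x ∂ν = ∫⁻ x, f x ∂ν) :
    P.Invariant ν := by
  refine Measure.ext_of_lintegral _ fun f hf => ?_
  rw [Measure.lintegral_bind P.aemeasurable hf.aemeasurable, h f hf]

theorem lintegral_of_invariant {α : Type*} [MeasurableSpace α] {ν : Measure α} {P : Kernel α α}
    (h : P.Invariant ν) {f : α → ℝ≥0∞} (hf : Measurable f) :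
    ∫⁻ x, ∫⁻ y, f y ∂P x ∂ν = ∫⁻ x, f x ∂ν := by
  rw [← Measure.lintegral_bind P.aemeasurable hf.aemeasurable, h.def]

variable {U : BlockSpace d → ℝ}

theorem lintegral_gibbsConditional_replaceBlock (hU : Continuous U)
    [IsProbabilityMeasure (gibbsMeasure U)] (m : Fin M) {f : BlockSpace d → ℝ≥0∞}
    (hf : Measurable f) :
    ∫⁻ x, ∫⁻ y, f (replaceBlock m x y) ∂gibbsConditional hU m x ∂gibbsMeasure U =
      ∫⁻ x, f x ∂gibbsMeasure U := by
  have h := lintegral_gibbsConditional_swap hU m (H := fun x _ => f x) (hf.comp measurable_fst)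
  rw [← h]
  simp

theorem invariant_blockKernel_gibbsConditional (hU : Continuous U)
    [IsProbabilityMeasure (gibbsMeasure U)] (m : Fin M) :
    (blockKernel m (gibbsConditional hU m)).Invariant (gibbsMeasure U) :=
  invariant_of_lintegral fun f hf => by
    simp only [lintegral_blockKernel m _ _ hf]
    exact lintegral_gibbsConditional_replaceBlock hU m hf

theorem measurePreserving_gibbsConditional (hU : Continuous U)
    [IsProbabilityMeasure (gibbsMeasure U)] (m : Fin M) :
    MeasurePreserving
      (fun p : BlockSpace d × EuclideanSpace ℝ (Fin (d m)) => replaceBlock m p.1 p.2)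
      (gibbsMeasure U ⊗ₘ gibbsConditional hU m) (gibbsMeasure U) := by
  refine ⟨measurable_replaceBlock_uncurry m, Measure.ext_of_lintegral _ fun f hf => ?_⟩
  have hc : Measurable fun p : BlockSpace d × EuclideanSpace ℝ (Fin (d m)) =>
      f (replaceBlock m p.1 p.2) := hf.comp (measurable_replaceBlock_uncurry m)
  rw [lintegral_map hf (measurable_replaceBlock_uncurry m),
    Measure.lintegral_compProd hc,
    lintegral_gibbsConditional_replaceBlock hU m hf]

theorem ae_gibbs_sliceMass_ne_top (hU : Continuous U) [IsProbabilityMeasure (gibbsMeasure U)]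
    (m : Fin M) : ∀ᵐ x ∂gibbsMeasure U, sliceMass U m x ≠ ∞ :=
  (gibbsMeasure_absolutelyContinuous U).ae_le (ae_sliceMass_ne_top hU m)

/-- Resampling block `m` from its full conditional leaves the Gibbs measure unchanged, so it may be
done before applying the kernel; invariance then reduces to that of the conditional update on almost
every slice. -/
theorem invariant_blockKernel (hU : Continuous U) [IsProbabilityMeasure (gibbsMeasure U)]
    (m : Fin M) (Q : Kernel (BlockSpace d) (EuclideanSpace ℝ (Fin (d m)))) [IsMarkovKernel Q]
    (hinv : ∀ x, (conditionalUpdate m Q x).Invariant (fullConditional U m x)) :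
    (blockKernel m Q).Invariant (gibbsMeasure U) := by
  refine invariant_of_lintegral fun f hf => ?_
  rw [← lintegral_gibbsConditional_replaceBlock hU m hf.lintegral_kernel,
    ← lintegral_gibbsConditional_replaceBlock hU m hf]
  refine lintegral_congr_ae ?_
  filter_upwards [ae_gibbs_sliceMass_ne_top hU m] with x hx
  have h := lintegral_of_invariant (hinv x) (hf.comp (measurable_replaceBlock m x))
  rw [gibbsConditional_apply hU m hx]
  refine Eq.trans (lintegral_congr fun z => ?_) h
  rw [lintegral_blockKernel m Q _ hf]
  simp only [replaceBlock_replaceBlock]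
  rfl

theorem measurable_ofReal_sub_sq {α : Type*} [MeasurableSpace α] {f : α → ℝ} (hf : Measurable f) :
    Measurable fun p : α × α => ENNReal.ofReal ((f p.1 - f p.2) ^ 2) := by
  fun_prop

theorem measurable_jumpEnergy_inner {α : Type*} [MeasurableSpace α] {P : Kernel α α}
    [IsMarkovKernel P] {f : α → ℝ} (hf : Measurable f) :
    Measurable fun x => ∫⁻ y, ENNReal.ofReal ((f x - f y) ^ 2) ∂P x :=
  (measurable_ofReal_sub_sq hf).lintegral_kernel_prod_right'

/-- The jump energy of a block kernel is the average of the jump energies of its conditional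
updates. -/
theorem jumpEnergy_blockKernel (hU : Continuous U) [IsProbabilityMeasure (gibbsMeasure U)]
    (m : Fin M) (Q : Kernel (BlockSpace d) (EuclideanSpace ℝ (Fin (d m)))) [IsMarkovKernel Q]
    {f : BlockSpace d → ℝ} (hf : Measurable f) :
    jumpEnergy (gibbsMeasure U) (blockKernel m Q) f =
      ∫⁻ x, jumpEnergy (gibbsConditional hU m x) (conditionalUpdate m Q x)
        (fun y => f (replaceBlock m x y)) ∂gibbsMeasure U := by
  rw [jumpEnergy, ← lintegral_gibbsConditional_replaceBlock hU m (measurable_jumpEnergy_inner hf)]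
  refine lintegral_congr fun x => lintegral_congr fun z => ?_
  rw [lintegral_blockKernel m Q _ (by fun_prop)]
  simp only [replaceBlock_replaceBlock]
  rfl

theorem conditionalUpdate_gibbsConditional (hU : Continuous U) (m : Fin M) (x : BlockSpace d) :
    conditionalUpdate m (gibbsConditional hU m) x =
      Kernel.const _ (gibbsConditional hU m x) := by
  ext z : 1
  exact gibbsConditional_replaceBlock hU m x z

/-- Both energies are averages over slices, and on almost every slice `f` is square integrable and
the gap bound of the conditional update compares the integrands. -/
theorem jumpEnergy_blockKernel_gibbsConditional_le (hU : Continuous U)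
    [IsProbabilityMeasure (gibbsMeasure U)] (m : Fin M)
    (Q : Kernel (BlockSpace d) (EuclideanSpace ℝ (Fin (d m)))) [IsMarkovKernel Q]
    (hinv : ∀ x, (conditionalUpdate m Q x).Invariant (fullConditional U m x)) {β : ℝ}
    (hβ : ∀ x, (β : EReal) ≤ spectralGap (fullConditional U m x) (conditionalUpdate m Q x))
    {f : BlockSpace d → ℝ} (hf : Measurable f) (hL : MemLp f 2 (gibbsMeasure U)) :
    ENNReal.ofReal β * jumpEnergy (gibbsMeasure U) (blockKernel m (gibbsConditional hU m)) f ≤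
      jumpEnergy (gibbsMeasure U) (blockKernel m Q) f := by
  rw [jumpEnergy_blockKernel hU m _ hf, jumpEnergy_blockKernel hU m _ hf,
    ← lintegral_const_mul' _ _ ENNReal.ofReal_ne_top]
  refine lintegral_mono_ae ?_
  have hL2 : ∀ᵐ x ∂gibbsMeasure U,
      MemLp (fun y => f (replaceBlock m x y)) 2 (gibbsConditional hU m x) := by
    have h2 : Integrable (fun p : BlockSpace d × EuclideanSpace ℝ (Fin (d m)) =>
        f (replaceBlock m p.1 p.2) ^ 2) (gibbsMeasure U ⊗ₘ gibbsConditional hU m) :=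
      (measurePreserving_gibbsConditional hU m).integrable_comp_of_integrable
        (g := fun x => f x ^ 2) hL.integrable_sq
    filter_upwards [((Measure.integrable_compProd_iff h2.aestronglyMeasurable).1 h2).1] with x hx
    exact (memLp_two_iff_integrable_sq
      (hf.comp (measurable_replaceBlock m x)).aestronglyMeasurable).2 hx
  filter_upwards [ae_gibbs_sliceMass_ne_top hU m, hL2] with x hx hxL
  rw [conditionalUpdate_gibbsConditional]
  have e := gibbsConditional_apply hU m hx
  refine ofReal_mul_jumpEnergy_le_of_le_spectralGap ?_ (hf.comp (measurable_replaceBlock m x)) hxL ?_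
  · rw [e]; exact hinv x
  · rw [e]; exact hβ x

end Kernels

/-! ### The Poincaré inequality for the Gibbs sampler -/

section GibbsGap

variable {M : ℕ} {d : Fin M → ℕ} {U : BlockSpace d → ℝ}

/-- The conditional expectation of `f` given `x_{-m}`. -/
noncomputable def gibbsAverage (hU : Continuous U) (m : Fin M) (f : BlockSpace d → ℝ)
    (x : BlockSpace d) : ℝ :=
  ∫ y, f (replaceBlock m x y) ∂gibbsConditional hU m x

theorem measurable_gibbsAverage (hU : Continuous U) (m : Fin M) {f : BlockSpace d → ℝ}
    (hf : Measurable f) : Measurable (gibbsAverage hU m f) :=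
  (StronglyMeasurable.integral_kernel_prod_right (f := fun x y => f (replaceBlock m x y))
    (hf.comp (measurable_replaceBlock_uncurry m)).stronglyMeasurable).measurable

theorem abs_gibbsAverage_le (hU : Continuous U) (m : Fin M) {f : BlockSpace d → ℝ} {C : ℝ}
    (hC : ∀ x, |f x| ≤ C) (x : BlockSpace d) : |gibbsAverage hU m f x| ≤ C := by
  rw [← Real.norm_eq_abs]
  exact (norm_integral_le_of_norm_le_const (.of_forall fun y => hC _)).trans (by simp)

theorem gibbsAverage_replaceBlock (hU : Continuous U) (m : Fin M) (f : BlockSpace d → ℝ)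
    (x : BlockSpace d) (y : EuclideanSpace ℝ (Fin (d m))) :
    gibbsAverage hU m f (replaceBlock m x y) = gibbsAverage hU m f x := by
  simp [gibbsAverage, gibbsConditional_replaceBlock]

theorem integral_gibbsAverage (hU : Continuous U) [IsProbabilityMeasure (gibbsMeasure U)]
    (m : Fin M) {f : BlockSpace d → ℝ} (hf : Measurable f) {C : ℝ} (hC : ∀ x, |f x| ≤ C) :
    ∫ x, gibbsAverage hU m f x ∂gibbsMeasure U = ∫ x, f x ∂gibbsMeasure U := by
  have hmp := measurePreserving_gibbsConditional hU m
  conv_rhs => rw [← hmp.map_eq]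
  rw [integral_map hmp.measurable.aemeasurable hf.aestronglyMeasurable, Measure.integral_compProd]
  · rfl
  · exact integrable_of_measurable_of_abs_le (hf.comp hmp.measurable) fun p => hC _

/-- The tower property: the average is constant along block `m`, so it factors out of the
conditional integral. -/
theorem integral_mul_gibbsAverage (hU : Continuous U) [IsProbabilityMeasure (gibbsMeasure U)]
    (m : Fin M) {f : BlockSpace d → ℝ} (hf : Measurable f) {C : ℝ} (hC : ∀ x, |f x| ≤ C) :
    ∫ x, f x * gibbsAverage hU m f x ∂gibbsMeasure U =
      ∫ x, gibbsAverage hU m f x ^ 2 ∂gibbsMeasure U := by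
  rw [← integral_gibbsAverage hU m (f := fun x => f x * gibbsAverage hU m f x)
    (hf.mul (measurable_gibbsAverage hU m hf)) (C := C * C) fun x => by
      rw [abs_mul]
      exact mul_le_mul (hC x) (abs_gibbsAverage_le hU m hC x) (abs_nonneg _)
        ((abs_nonneg _).trans (hC x))]
  refine integral_congr_ae (.of_forall fun x => ?_)
  change ∫ y, f (replaceBlock m x y) * gibbsAverage hU m f (replaceBlock m x y)
    ∂gibbsConditional hU m x = _
  simp only [gibbsAverage_replaceBlock]
  rw [integral_mul_const, sq]
  rfl

theorem dirichletForm_blockKernel_gibbsConditional (hU : Continuous U)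
    [IsProbabilityMeasure (gibbsMeasure U)]
    (m : Fin M) {f : BlockSpace d → ℝ} (hf : Measurable f) {C : ℝ} (hC : ∀ x, |f x| ≤ C) :
    dirichletForm (gibbsMeasure U) (blockKernel m (gibbsConditional hU m)) f =
      ∫ x, f x ^ 2 ∂gibbsMeasure U - ∫ x, gibbsAverage hU m f x ^ 2 ∂gibbsMeasure U := by
  have h1 : ∀ x, ∫ y, f y ∂blockKernel m (gibbsConditional hU m) x = gibbsAverage hU m f x := by
    intro x
    rw [blockKernel_apply, integral_map (measurable_replaceBlock m x).aemeasurable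
      hf.aestronglyMeasurable]
    rfl
  have hav := measurable_gibbsAverage hU m hf
  have i1 : Integrable (fun x => f x ^ 2) (gibbsMeasure U) :=
    integrable_of_measurable_of_abs_le (by fun_prop) (C := C ^ 2) fun x => by
      rw [abs_pow]; exact pow_le_pow_left₀ (abs_nonneg _) (hC x) 2
  have i2 : Integrable (fun x => f x * gibbsAverage hU m f x) (gibbsMeasure U) :=
    integrable_of_measurable_of_abs_le (by fun_prop) (C := C * C) fun x => by
      rw [abs_mul]
      exact mul_le_mul (hC x) (abs_gibbsAverage_le hU m hC x) (abs_nonneg _)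
        ((abs_nonneg _).trans (hC x))
  rw [← integral_mul_gibbsAverage hU m hf hC, dirichletForm, ← integral_sub i1 i2]
  refine integral_congr_ae (.of_forall fun x => ?_)
  simp only [h1]
  ring

variable {U₀ : BlockSpace d → ℝ} {V : ∀ m : Fin M, EuclideanSpace ℝ (Fin (d m)) → ℝ}
  {L : Fin M → ℝ≥0} {lam : ℝ}

/-- A duality argument. Put `q = M - t`, `S = ∑ ‖a m‖²` and `F = ‖f‖²`. Projection gives `⟨f, ∑ a m⟩
= S`, and the linearised Loomis–Whitney bound gives `‖∑ a m‖² ≤ q S`. Hence `0 ≤ ‖q f - ∑ a m‖² ≤ q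
(q F - S)`. -/
theorem BlockConvexSmooth.sum_integral_gibbsAverage_sq_le (hM : 0 < M)
    (hU : BlockConvexSmooth U U₀ V L lam) {t : ℝ} (ht0 : 0 < t) (ht1 : t < 1) (htl : t ≤ lam)
    {f : BlockSpace d → ℝ} (hf : Measurable f) {C : ℝ} (hC : ∀ x, |f x| ≤ C)
    (hf0 : ∫ x, f x ∂gibbsMeasure U = 0) :
    ∑ m, ∫ x, gibbsAverage hU.continuous m f x ^ 2 ∂gibbsMeasure U ≤
      (M - t) * ∫ x, f x ^ 2 ∂gibbsMeasure U := by
  have := hU.isProbabilityMeasure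
  have hM1 : (1 : ℝ) ≤ M := by exact_mod_cast hM
  have hq0 : (0 : ℝ) < M - t := by linarith
  set a : Fin M → BlockSpace d → ℝ := fun m => gibbsAverage hU.continuous m f with ha
  have ham : ∀ m, Measurable (a m) := fun m => measurable_gibbsAverage hU.continuous m hf
  have haC : ∀ m x, |a m x| ≤ C := fun m => abs_gibbsAverage_le hU.continuous m hC
  have key := integral_sum_sq_le_of_lintegral_exp_le (μ := gibbsMeasure U) ham haC
    (fun m => (integral_gibbsAverage hU.continuous m hf hC).trans hf0) hq0 fun e =>
      hU.lintegral_exp_sum_le hM ht0 ht1 htl (a := fun m x => e * a m x)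
        (fun m => (ham m).const_mul e) (C := |e| * C)
        (fun m x => by rw [abs_mul]; exact mul_le_mul_of_nonneg_left (haC m x) (abs_nonneg e))
        (fun m x y => by simp only [ha, gibbsAverage_replaceBlock])
  have hfL : MemLp f 2 (gibbsMeasure U) := .of_bound hf.aestronglyMeasurable C (.of_forall hC)
  have haL : ∀ m, MemLp (a m) 2 (gibbsMeasure U) := fun m =>
    .of_bound (ham m).aestronglyMeasurable C (.of_forall (haC m))
  have hSL : MemLp (fun x => ∑ m, a m x) 2 (gibbsMeasure U) :=
    memLp_finsetSum _ fun m _ => haL m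
  have hcross : ∫ x, f x * ∑ m, a m x ∂gibbsMeasure U = ∑ m, ∫ x, a m x ^ 2 ∂gibbsMeasure U := by
    simp only [Finset.mul_sum]
    have hi : ∀ m, Integrable (fun x => f x * a m x) (gibbsMeasure U) :=
      fun m => hfL.integrable_mul (haL m)
    rw [integral_finsetSum _ fun m _ => hi m]
    exact Finset.sum_congr rfl fun m _ => integral_mul_gibbsAverage hU.continuous m hf hC
  have h0 : 0 ≤ ∫ x, ((M - t) * f x - ∑ m, a m x) ^ 2 ∂gibbsMeasure U :=
    integral_nonneg fun x => sq_nonneg _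
  have i1 : Integrable (fun x => f x ^ 2) (gibbsMeasure U) := hfL.integrable_sq
  have i2 : Integrable (fun x => f x * ∑ m, a m x) (gibbsMeasure U) := hfL.integrable_mul hSL
  have i3 : Integrable (fun x => (∑ m, a m x) ^ 2) (gibbsMeasure U) := hSL.integrable_sq
  have e : ∫ x, ((M - t) * f x - ∑ m, a m x) ^ 2 ∂gibbsMeasure U =
      (M - t) ^ 2 * ∫ x, f x ^ 2 ∂gibbsMeasure U -
        2 * (M - t) * ∫ x, f x * ∑ m, a m x ∂gibbsMeasure U +
        ∫ x, (∑ m, a m x) ^ 2 ∂gibbsMeasure U := by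
    have i4 : Integrable (fun x => (M - t) ^ 2 * f x ^ 2 - 2 * (M - t) * (f x * ∑ m, a m x))
      (gibbsMeasure U) := (i1.const_mul _).sub (i2.const_mul _)
    rw [← integral_const_mul, ← integral_const_mul,
      ← integral_sub (i1.const_mul _) (i2.const_mul _), ← integral_add i4 i3]
    refine integral_congr_ae (.of_forall fun x => ?_)
    ring
  rw [e, hcross] at h0
  set S := ∑ m, ∫ x, a m x ^ 2 ∂gibbsMeasure U
  set F := ∫ x, f x ^ 2 ∂gibbsMeasure U
  have h1 : 0 ≤ (M - t) * ((M - t) * F - S) := by nlinarith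
  have h2 := nonneg_of_mul_nonneg_right h1 hq0
  linarith

theorem BlockConvexSmooth.jumpEnergy_le_of_bounded (hM : 0 < M)
    (hU : BlockConvexSmooth U U₀ V L lam) {t : ℝ} (ht0 : 0 < t) (ht1 : t < 1) (htl : t ≤ lam)
    {f : BlockSpace d → ℝ} (hf : Measurable f) {C : ℝ} (hC : ∀ x, |f x| ≤ C) :
    ENNReal.ofReal t * jumpEnergy (gibbsMeasure U) (Kernel.const _ (gibbsMeasure U)) f ≤
      ∑ m, jumpEnergy (gibbsMeasure U) (blockKernel m (gibbsConditional hU.continuous m)) f := by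
  have := hU.isProbabilityMeasure
  set c := ∫ x, f x ∂gibbsMeasure U with hc
  set g : BlockSpace d → ℝ := fun x => f x - c with hg
  have hgm : Measurable g := hf.sub_const c
  have hgC : ∀ x, |g x| ≤ C + |c| := fun x =>
    (abs_sub _ _).trans (add_le_add (hC x) le_rfl)
  have hgL : MemLp g 2 (gibbsMeasure U) :=
    .of_bound hgm.aestronglyMeasurable (C + |c|) (.of_forall hgC)
  have hg0 : ∫ x, g x ∂gibbsMeasure U = 0 := by
    rw [hg, integral_sub (integrable_of_measurable_of_abs_le hf hC) (integrable_const _)]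
    simp [hc]
  have hfg : ∀ P : Kernel (BlockSpace d) (BlockSpace d),
      jumpEnergy (gibbsMeasure U) P f = jumpEnergy (gibbsMeasure U) P g := fun P => by
    simp [jumpEnergy, hg]
  have hvar : variance g (gibbsMeasure U) = ∫ x, g x ^ 2 ∂gibbsMeasure U := by
    rw [variance_of_integral_eq_zero hgm.aemeasurable hg0]
  have hD := fun m => ofReal_two_mul_dirichletForm
    (invariant_blockKernel_gibbsConditional hU.continuous m) hgm hgL
  have key := hU.sum_integral_gibbsAverage_sq_le hM ht0 ht1 htl hgm hgC hg0
  simp only [hfg]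
  rw [← ofReal_two_mul_variance hgm hgL, Finset.sum_congr rfl fun m _ => (hD m).2.symm,
    ← ENNReal.ofReal_sum_of_nonneg fun m _ => mul_nonneg zero_le_two (hD m).1,
    ← ENNReal.ofReal_mul ht0.le]
  refine ENNReal.ofReal_le_ofReal ?_
  simp only [dirichletForm_blockKernel_gibbsConditional hU.continuous _ hgm hgC]
  rw [← Finset.mul_sum, Finset.sum_sub_distrib, hvar]
  simp only [Finset.sum_const, Finset.card_univ, Fintype.card_fin, nsmul_eq_mul]
  linarith

theorem jumpEnergy_comp_le {α : Type*} [MeasurableSpace α] {ν : Measure α} {P : Kernel α α}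
    {φ : ℝ → ℝ} (hφ : ∀ a b, |φ a - φ b| ≤ |a - b|) (f : α → ℝ) :
    jumpEnergy ν P (fun x => φ (f x)) ≤ jumpEnergy ν P f :=
  lintegral_mono fun _ => lintegral_mono fun _ =>
    ENNReal.ofReal_le_ofReal (sq_le_sq.2 (hφ _ _))

/-- Fatou's lemma, since truncations at level `n` are eventually exact at each point. It removes the
boundedness needed for exponential moments. -/
theorem jumpEnergy_le_of_forall_truncation {α : Type*} [MeasurableSpace α] {ν : Measure α}
    [IsProbabilityMeasure ν] {P : Kernel α α} [IsMarkovKernel P] {f : α → ℝ} (hf : Measurable f)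
    {B : ℝ≥0∞} (h : ∀ n : ℕ, jumpEnergy ν P (fun x => max (-(n : ℝ)) (min n (f x))) ≤ B) :
    jumpEnergy ν P f ≤ B := by
  have hF : ∀ {g : α → ℝ}, Measurable g →
      jumpEnergy ν P g = ∫⁻ p, ENNReal.ofReal ((g p.1 - g p.2) ^ 2) ∂(ν ⊗ₘ P) := fun hg => by
    rw [Measure.lintegral_compProd (by fun_prop), jumpEnergy]
  have hfn : ∀ n : ℕ, Measurable fun x => max (-(n : ℝ)) (min n (f x)) := fun n => by fun_prop
  have hlim : ∀ p : α × α, ENNReal.ofReal ((f p.1 - f p.2) ^ 2) =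
      Filter.liminf (fun n : ℕ => ENNReal.ofReal ((max (-(n : ℝ)) (min n (f p.1)) -
        max (-(n : ℝ)) (min n (f p.2))) ^ 2)) Filter.atTop := by
    intro p
    refine (Filter.Tendsto.liminf_eq ?_).symm
    refine tendsto_const_nhds.congr' ?_
    have htr : ∀ a : ℝ, ∀ᶠ n : ℕ in Filter.atTop, max (-(n : ℝ)) (min n a) = a := by
      intro a
      obtain ⟨N, hN⟩ := exists_nat_ge |a|
      filter_upwards [Filter.eventually_ge_atTop N] with n hn
      have hn' : |a| ≤ n := hN.trans (by exact_mod_cast hn)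
      rw [min_eq_right (abs_le.1 hn').2, max_eq_right (abs_le.1 hn').1]
    filter_upwards [htr (f p.1), htr (f p.2)] with n h1 h2
    rw [h1, h2]
  rw [hF hf, lintegral_congr hlim]
  refine (lintegral_liminf_le fun n => ?_).trans ?_
  · have := hfn n
    fun_prop
  · refine Filter.liminf_le_of_le (by isBoundedDefault) fun b hb => ?_
    obtain ⟨n, hn⟩ := hb.exists
    refine hn.trans ?_
    rw [← hF (hfn n)]
    exact h n

theorem abs_max_min_sub_le (n a b : ℝ) :
    |max (-n) (min n a) - max (-n) (min n b)| ≤ |a - b| := by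
  refine (abs_max_sub_max_le_max _ _ _ _).trans ?_
  refine max_le (by simp) ((abs_min_sub_min_le_max _ _ _ _).trans ?_)
  simp

/-- The Poincaré inequality for the Gibbs sampler. -/
theorem BlockConvexSmooth.jumpEnergy_le (hM : 0 < M)
    (hU : BlockConvexSmooth U U₀ V L lam) {t : ℝ} (ht0 : 0 < t) (ht1 : t < 1) (htl : t ≤ lam)
    {f : BlockSpace d → ℝ} (hf : Measurable f) :
    ENNReal.ofReal t * jumpEnergy (gibbsMeasure U) (Kernel.const _ (gibbsMeasure U)) f ≤
      ∑ m, jumpEnergy (gibbsMeasure U) (blockKernel m (gibbsConditional hU.continuous m)) f := by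
  have := hU.isProbabilityMeasure
  have ht : ENNReal.ofReal t ≠ 0 := by simpa using ht0
  rw [mul_comm, ← ENNReal.le_div_iff_mul_le (Or.inl ht) (Or.inl ENNReal.ofReal_ne_top)]
  refine jumpEnergy_le_of_forall_truncation hf fun n => ?_
  rw [ENNReal.le_div_iff_mul_le (Or.inl ht) (Or.inl ENNReal.ofReal_ne_top), mul_comm]
  refine (hU.jumpEnergy_le_of_bounded hM ht0 ht1 htl (by fun_prop) (C := n) fun x => ?_).trans
    (Finset.sum_le_sum fun m _ => jumpEnergy_comp_le (abs_max_min_sub_le n) f)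
  have hn : (0 : ℝ) ≤ n := Nat.cast_nonneg n
  exact abs_le.2 ⟨le_max_left _ _, max_le (by linarith) (min_le_left _ _)⟩

end GibbsGap

/-! ### The gap of Metropolis-within-Gibbs -/

theorem mainTheorem11 {M : ℕ} (hM : 0 < M) (d : Fin M → ℕ)
    (U U₀ : BlockSpace d → ℝ) (V : ∀ m : Fin M, EuclideanSpace ℝ (Fin (d m)) → ℝ)
    (L : Fin M → ℝ≥0) (lam : ℝ) (hU : BlockConvexSmooth U U₀ V L lam)
    (Q : ∀ m : Fin M, Kernel (BlockSpace d) (EuclideanSpace ℝ (Fin (d m))))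
    (hQ : ∀ m : Fin M, IsMarkovKernel (Q m))
    (hrev : ∀ (m : Fin M) (x : BlockSpace d),
      (conditionalUpdate m (Q m) x).IsReversible (fullConditional U m x))
    (β : ℝ)
    (hβ : (β : EReal) ≤ ⨅ (x : BlockSpace d) (m : Fin M),
      spectralGap (fullConditional U m x) (conditionalUpdate m (Q m) x)) :
    ((β / (2 * blockConditionNumber lam * (M : ℝ)) : ℝ) : EReal) ≤
      spectralGap (gibbsMeasure U) (metropolisWithinGibbs Q) := by
  have := hU.isProbabilityMeasure
  have := isMarkovKernel_metropolisWithinGibbs hM Q hQ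
  have hM0 : (0 : ℝ) < M := by exact_mod_cast hM
  have hinv : ∀ m x, (conditionalUpdate m (Q m) x).Invariant (fullConditional U m x) :=
    fun m x => (hrev m x).invariant
  have hP : (metropolisWithinGibbs Q).Invariant (gibbsMeasure U) := by
    refine invariant_of_lintegral fun f hf => ?_
    simp only [lintegral_metropolisWithinGibbs]
    rw [lintegral_const_mul _ (Finset.measurable_fun_sum _ fun m _ => hf.lintegral_kernel),
      lintegral_finsetSum _ fun m _ => hf.lintegral_kernel]
    rw [Finset.sum_congr rfl fun m _ => lintegral_of_invariant
      (invariant_blockKernel hU.continuous m (Q m) (hinv m)) hf]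
    simp only [Finset.sum_const, Finset.card_univ, Fintype.card_fin, nsmul_eq_mul]
    rw [← mul_assoc, ENNReal.inv_mul_cancel (by simpa using hM.ne') (by simp), one_mul]
  refine le_iInf fun f => le_iInf fun hL => le_iInf fun hv => ?_
  -- If every block has dimension 0, the space is a point and all variances vanish, so some block is
  -- nontrivial and bounds `lam`.
  have hlam : lam ≤ 1 := by
    by_contra hl
    have hd : ∀ m, d m = 0 := fun m => by
      by_contra hm
      exact hl (hU.lam_le_one m hm)
    have : ∀ m, IsEmpty (Fin (d m)) := fun m => by rw [hd m]; infer_instance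
    refine hv ?_
    have hf : f = fun _ => f 0 := funext fun x => congrArg f (Subsingleton.elim _ _)
    rw [hf, variance_eq_integral aemeasurable_const]
    simp
  set g := hL.1.mk f with hg
  have hfg : f =ᵐ[gibbsMeasure U] g := hL.1.ae_eq_mk
  have hgm : Measurable g := hL.1.stronglyMeasurable_mk.measurable
  have hgL : MemLp g 2 (gibbsMeasure U) := (memLp_congr_ae hfg).1 hL
  rw [dirichletForm_congr_ae hP hfg, variance_congr hfg]
  rw [variance_congr hfg] at hv
  have hvpos : 0 < variance g (gibbsMeasure U) :=
    lt_of_le_of_ne (variance_nonneg _ _) (Ne.symm hv)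
  obtain ⟨hD0, hD⟩ := ofReal_two_mul_dirichletForm hP hgm hgL
  have hsum : jumpEnergy (gibbsMeasure U) (metropolisWithinGibbs Q) g =
      (M : ℝ≥0∞)⁻¹ * ∑ m, jumpEnergy (gibbsMeasure U) (blockKernel m (Q m)) g := by
    simp only [jumpEnergy, lintegral_metropolisWithinGibbs]
    rw [lintegral_const_mul _ (Finset.measurable_fun_sum _ fun m _ =>
      measurable_jumpEnergy_inner hgm), lintegral_finsetSum _ fun m _ =>
      measurable_jumpEnergy_inner hgm]
  have hgap : ∀ m, ENNReal.ofReal β * jumpEnergy (gibbsMeasure U)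
      (blockKernel m (gibbsConditional hU.continuous m)) g ≤
      jumpEnergy (gibbsMeasure U) (blockKernel m (Q m)) g := fun m =>
    jumpEnergy_blockKernel_gibbsConditional_le hU.continuous m (Q m) (hinv m)
      (fun x => hβ.trans (iInf_le_of_le x (iInf_le _ m))) hgm hgL
  have hlam0 := hU.lam_pos
  -- The Poincaré inequality needs `t < 1` strictly while `lam = 1` is possible. The choice `t = lam
  -- / 2` is safe and produces the factor 2 of the bound.
  have hgibbs := hU.jumpEnergy_le hM (t := lam / 2) (by linarith) (by linarith) (by linarith) hgm
  have hMi : (M : ℝ≥0∞)⁻¹ = ENNReal.ofReal (M : ℝ)⁻¹ := by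
    rw [ENNReal.ofReal_inv_of_pos hM0, ENNReal.ofReal_natCast]
  have hmain : ENNReal.ofReal ((M : ℝ)⁻¹ * (β * (lam / 2 * (2 * variance g (gibbsMeasure U))))) ≤
      ENNReal.ofReal (2 * dirichletForm (gibbsMeasure U) (metropolisWithinGibbs Q) g) := by
    rw [hD, hsum, ENNReal.ofReal_mul (by positivity), ENNReal.ofReal_mul' (by positivity),
      ENNReal.ofReal_mul (by positivity), ofReal_two_mul_variance hgm hgL, ← hMi]
    gcongr
    refine (mul_le_mul_right hgibbs _).trans ?_
    rw [Finset.mul_sum]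
    exact Finset.sum_le_sum fun m _ => hgap m
  -- Negative `β` is covered: the left side is then truncated to 0, and returning to real numbers
  -- needs only a nonnegative right side.
  rw [ENNReal.ofReal_le_ofReal_iff (by linarith)] at hmain
  rw [EReal.coe_le_coe_iff, le_div_iff₀ hvpos, blockConditionNumber]
  have e : β / (2 * (1 / lam) * M) * variance g (gibbsMeasure U) =
      (M : ℝ)⁻¹ * (β * (lam / 2 * (2 * variance g (gibbsMeasure U)))) / 2 := by
    field_simp
  rw [e]
  linarith
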